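/- Let $N\in\mathbb N$, $T>0$, $r_0>0$, and let $A_\epsilon(t)\in\mathbb C^{N\times N}$ ($\epsilon\in\mathbb C$, $|\epsilon|<r_0$, $t\in\mathbb R$) be a matrix-valued function that is jointly continuous in $(\epsilon,t)$, $T$-periodic in $t$, and given for all $|\epsilon|<r_0$ and all $t\in\mathbb R$ by a convergent power series $$A_\epsilon(t)=A_0+\epsilon A_1(t)+\epsilon^2A_2(t)+\cdots ,$$ with $r_0$ independent of $t$. Suppose that $A_0=\operatorname{diag}(a_1,\dots,a_N)$ is constant and diagonal, and that every $A_n$, $n\ge1$, has a finite Fourier series: $A_n(t)=\sum_{m}e^{\frac{2\pi i}{T}mt}A_n^m$, a finite sum over integers $m$. A *Floquet–Lyapunov decomposition depending analytically on $\epsilon$* consists of matrices $F_\epsilon=\sum_{n\ge0}\epsilon^nF_n$ and jointly continuous matrix functions $P_\epsilon(t)=\sum_{n\ge0}\epsilon^nP_n(t)$, the series converging for $|\epsilon|<r$ and all $t\in\mathbb R$, with some $0<r\le r_0$ independent of $t$, such that for every $|\epsilon|<r$ the function $P_\epsilon$ is $T$-periodic and $X_\epsilon(t)=P_\epsilon(t)\exp(F_\epsilon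 t)$ is the fundamental solution of $dx/dt=A_\epsilon(t)x$, that is, $X_\epsilon'(t)=A_\epsilon(t)X_\epsilon(t)$ and $X_\epsilon(0)=\mathrm{Id}$. Call a diagonal matrix $F_0=\operatorname{diag}(f_1,\dots,f_N)$ *feasible* if $a_k-f_k=\frac{2\pi i}{T}\nu_k$ with $\nu_k\in\mathbb Z$ for all $k$, and no two distinct entries $f_k\ne f_l$ are congruent modulo $\frac{2\pi i}{T}\mathbb Z$. 1. There is exactly one diagonal matrix $F_0$ with $F_0\equiv A_0 \bmod \operatorname{diag}(\frac{2\pi i}{T}\mathbb Z,\dots,\frac{2\pi i}{T}\mathbb Z)$ whose diagonal entries have imaginary parts in $(-\frac{\pi}{T},\frac{\pi}{T}]$, and it is feasible. 2. For every feasible $F_0$, and in particular for the one in 1, there is a Floquet–Lyapunov decomposition of $dx/dt=A_\epsilon(t)x$ depending analytically on $\epsilon$ with leading coefficient $F_0$. All its coefficients $F_n$, $P_n$ are uniquely determined by $F_0$: any two such decompositions with the same $F_0$ have the same $F_n$ and $P_n$ for all $n\ge0$. Moreover $P_0(t)=\exp((A_0-F_0)t)$, and for every $n\ge1$ there are matrices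 $\Phi^m$, $m\in\mathbb Z$, only finitely many nonzero, with $$\sum_{i=1}^{n-1}\bigl(A_i(t)P_{n-i}(t)-P_{n-i}(t)F_i\bigr)+A_n(t)P_0(t)=\sum_{m\in\mathbb Z}e^{\frac{2\pi i}{T}mt}\,\Phi^m\qquad(t\in\mathbb R),$$ and, for all $k,l$ and $t$, $$(F_n)_{kl}=\begin{cases}(\Phi^{\nu_k})_{kl}&\text{if }f_k=f_l,\\[4pt](f_l-f_k)\displaystyle\sum_{m\in\mathbb Z}\frac{(\Phi^m)_{kl}}{\frac{2\pi i}{T}m-a_k+f_l}&\text{if }f_k\ne f_l,\end{cases}$$ $$(P_n(t))_{kl}=\sum_{m\in\mathbb Z}e^{\frac{2\pi i}{T}mt}\begin{cases}\displaystyle\frac{(\Phi^m)_{kl}}{\frac{2\pi i}{T}m-a_k+f_l}&\text{if }m\ne\nu_k,\\[8pt]-\displaystyle\sum_{m'\ne\nu_k}\frac{(\Phi^{m'})_{kl}}{\frac{2\pi i}{T}m'-a_k+f_l}&\text{if }m=\nu_k.\end{cases}$$ -/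

import Mathlib

open scoped Matrix Topology

noncomputable section

namespace FloquetLyapunov

variable {N : ℕ}

/-- The angular frequency `2πi / T`, as a complex number. -/
def freq (T : ℝ) : ℂ := 2 * (Real.pi : ℂ) * Complex.I / (T : ℂ)

/-- The trigonometric polynomial `t ↦ ∑ₘ exp((2πi/T) m t) Φᵐ` with finitely many nonzero matrix
coefficients `Φᵐ`, `m ∈ ℤ`. -/
def trigPoly (T : ℝ) (Φ : ℤ →₀ Matrix (Fin N) (Fin N) ℂ) (t : ℝ) : Matrix (Fin N) (Fin N) ℂ :=
  ∑ m ∈ Φ.support, Complex.exp (freq T * (m : ℂ) * (t : ℂ)) • Φ m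

/-- `B` is a `T`-periodic function with a finite Fourier series. -/
def HasFiniteFourierSeries (T : ℝ) (B : ℝ → Matrix (Fin N) (Fin N) ℂ) : Prop :=
  ∃ Φ : ℤ →₀ Matrix (Fin N) (Fin N) ℂ, ∀ t, B t = trigPoly T Φ t

/-- The family `B ε t` is continuous on `{|ε| < r} × ℝ` and is given there by the power series
`B ε t = b 0 t + ε b 1 t + ε² b 2 t + …`; the radius `r` does not depend on `t`. -/
structure IsAnalyticFamily (r : ℝ) (B : ℂ → ℝ → Matrix (Fin N) (Fin N) ℂ)
    (b : ℕ → ℝ → Matrix (Fin N) (Fin N) ℂ) : Prop where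
  continuousOn : ContinuousOn (fun p : ℂ × ℝ => B p.1 p.2) (Metric.ball (0 : ℂ) r ×ˢ Set.univ)
  hasSum : ∀ ε : ℂ, ‖ε‖ < r → ∀ t : ℝ, HasSum (fun n : ℕ => ε ^ n • b n t) (B ε t)

/-- `X` is the fundamental solution: `dX/dt = A(t) X` (entry by entry) and `X(0) = Id`. -/
structure IsFundamentalSolution (A X : ℝ → Matrix (Fin N) (Fin N) ℂ) : Prop where
  initial : X 0 = 1
  deriv : ∀ (t : ℝ) (k l : Fin N), HasDerivAt (fun s : ℝ => X s k l) ((A t * X t) k l) t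

/-- `(P, F)` is a Floquet-Lyapunov decomposition of `dx/dt = A(t) x`: `P` is `T`-periodic and
`t ↦ P(t) exp(F t)` is the fundamental solution. -/
structure IsFloquetDecomposition (T : ℝ) (A P : ℝ → Matrix (Fin N) (Fin N) ℂ)
    (F : Matrix (Fin N) (Fin N) ℂ) : Prop where
  periodic : Function.Periodic P T
  fundamental : IsFundamentalSolution A (fun t => P t * NormedSpace.exp (t • F))

/-- The sequences `F n`, `P n` are the Taylor coefficients in `ε` at `0` of a Floquet-Lyapunov
decomposition of `dx/dt = A_ε(t) x` that depends analytically on `ε` on some disc `|ε| < r`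
(contained in the disc `|ε| < r₀` on which `A_ε` is considered). -/
def IsAnalyticFloquetExpansion (T r₀ : ℝ) (A : ℂ → ℝ → Matrix (Fin N) (Fin N) ℂ)
    (F : ℕ → Matrix (Fin N) (Fin N) ℂ) (P : ℕ → ℝ → Matrix (Fin N) (Fin N) ℂ) : Prop :=
  ∃ r : ℝ, 0 < r ∧ r ≤ r₀ ∧
    ∃ (Fε : ℂ → Matrix (Fin N) (Fin N) ℂ) (Pε : ℂ → ℝ → Matrix (Fin N) (Fin N) ℂ),
      (∀ ε : ℂ, ‖ε‖ < r → HasSum (fun n : ℕ => ε ^ n • F n) (Fε ε)) ∧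
      IsAnalyticFamily r Pε P ∧
      ∀ ε : ℂ, ‖ε‖ < r → IsFloquetDecomposition T (A ε) (Pε ε) (Fε ε)

/-- `diag f` is congruent to `diag a` modulo `diag((2πi/T)ℤ, …, (2πi/T)ℤ)`, and `ν` are the
folding numbers: `a k - f k = (2πi/T) ν k`. -/
def IsFolding (T : ℝ) (a f : Fin N → ℂ) (ν : Fin N → ℤ) : Prop :=
  ∀ k, a k - f k = freq T * (ν k : ℂ)

/-- All entries of `f` have imaginary part in the first Brillouin zone `(-π/T, π/T]`. -/
def InBrillouinZone (T : ℝ) (f : Fin N → ℂ) : Prop :=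
  ∀ k, -(Real.pi / T) < (f k).im ∧ (f k).im ≤ Real.pi / T

/-- No two distinct entries of `f` are congruent modulo `2πi/T`. -/
def IsNonresonant (T : ℝ) (f : Fin N → ℂ) : Prop :=
  ∀ k l, f k ≠ f l → ∀ q : ℤ, f k - f l ≠ freq T * (q : ℂ)

/-- `∑_{i=1}^{n-1} (A_i(t) P_{n-i}(t) - P_{n-i}(t) F_i) + A_n(t) P_0(t)`. -/
def source (A : ℕ → ℝ → Matrix (Fin N) (Fin N) ℂ) (F : ℕ → Matrix (Fin N) (Fin N) ℂ)
    (P : ℕ → ℝ → Matrix (Fin N) (Fin N) ℂ) (n : ℕ) (t : ℝ) : Matrix (Fin N) (Fin N) ℂ :=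
  ∑ i ∈ Finset.Ico 1 n, (A i t * P (n - i) t - P (n - i) t * F i) + A n t * P 0 t

/-- The quotient `(Φᵐ)ₖₗ / ((2πi/T) m - aₖ + fₗ)`. -/
def quot (T : ℝ) (a f : Fin N → ℂ) (Φ : ℤ →₀ Matrix (Fin N) (Fin N) ℂ) (k l : Fin N) (m : ℤ) : ℂ :=
  Φ m k l / (freq T * (m : ℂ) - a k + f l)

/-- The formula for `F_n` in terms of the Fourier coefficients `Φᵐ`; the sums over `m ∈ ℤ` have
nonzero terms only for `m` in the support of `Φ`. -/
def FormulaF (T : ℝ) (a f : Fin N → ℂ) (ν : Fin N → ℤ) (Φ : ℤ →₀ Matrix (Fin N) (Fin N) ℂ)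
    (Fn : Matrix (Fin N) (Fin N) ℂ) : Prop :=
  ∀ k l,
    (f k = f l → Fn k l = Φ (ν k) k l) ∧
    (f k ≠ f l → Fn k l = (f l - f k) * ∑ m ∈ Φ.support, quot T a f Φ k l m)

/-- The `m`-th Fourier coefficient of `(P_n)ₖₗ`; for a folding `ν`, the condition `m = ν k` says
`(2πi/T) m = aₖ - fₖ`. -/
def coeffP (T : ℝ) (a f : Fin N → ℂ) (ν : Fin N → ℤ) (Φ : ℤ →₀ Matrix (Fin N) (Fin N) ℂ)
    (k l : Fin N) (m : ℤ) : ℂ :=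
  if m = ν k then -∑ m' ∈ Φ.support.erase (ν k), quot T a f Φ k l m' else quot T a f Φ k l m

/-- The formula for `P_n` in terms of the Fourier coefficients `Φᵐ`; the terms of the sum over
`m ∈ ℤ` vanish unless `m = ν k` or `m` is in the support of `Φ`. -/
def FormulaP (T : ℝ) (a f : Fin N → ℂ) (ν : Fin N → ℤ) (Φ : ℤ →₀ Matrix (Fin N) (Fin N) ℂ)
    (Pn : ℝ → Matrix (Fin N) (Fin N) ℂ) : Prop :=
  ∀ (t : ℝ) (k l : Fin N),
    Pn t k l = ∑ m ∈ insert (ν k) Φ.support,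
      Complex.exp (freq T * (m : ℂ) * (t : ℂ)) * coeffP T a f ν Φ k l m

end FloquetLyapunov

end

noncomputable section

namespace FloquetLyapunov

/-! ### Operator norm and derivatives of matrices, entry by entry -/

section MatrixNorm

open scoped Matrix.Norms.Operator

variable {N : ℕ}

/-! The pair `(P, F)` is a Floquet decomposition exactly when `P` is periodic, `P 0 = 1` and `P' = A
P - P F`. At order `ε ^ n` this reads `P_n' = A_0 P_n - P_n F_0 + S_n - P_0 F_n` with `P_n 0 = 0`,
where `S_n` is `source`, built from lower orders. Comparing Fourier modes solves it: only the mode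
`ν k` of row `k` sees `F_n`. Where `f k = f l`, that mode is resonant and fixes `F_n`; where `f k ≠
f l`, it instead balances the other modes so that `P_n 0 = 0`. Nonresonance keeps all other
denominators nonzero (`hasDerivAt_of_formula`).

Convergence and uniqueness both rest on the a priori bound `exists_matrix_bound`: if `Q` vanishes at
`0` and `T` and solves the linear equation with inhomogeneity `S` and free constant matrix `D`, then
`D` and `Q` are at most a constant times the supremum of `S`. Applied to `(P_n, F_n)` it yields a
quadratic convolution inequality for the norms, hence geometric growth
(`exists_geometric_bound_of_quadratic_recursion`), and the summed series may be differentiated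
termwise. Applied to the difference of two decompositions at a small fixed `ε`, where the
inhomogeneity is a small multiple of the difference itself, it forces the difference to vanish
(`floquet_eq_of_close`); equal functions near `0` have equal Taylor coefficients. -/

theorem norm_entry_le (M : Matrix (Fin N) (Fin N) ℂ) (k l : Fin N) : ‖M k l‖ ≤ ‖M‖ := by
  rw [Matrix.linfty_opNorm_def]
  have h1 : ‖M k l‖₊ ≤ ∑ j, ‖M k j‖₊ :=
    Finset.single_le_sum (f := fun j => ‖M k j‖₊) (fun _ _ => zero_le) (Finset.mem_univ l)
  have h2 := Finset.le_sup (f := fun i => ∑ j, ‖M i j‖₊) (Finset.mem_univ k)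
  exact_mod_cast h1.trans h2

theorem norm_le_of_entry_le (M : Matrix (Fin N) (Fin N) ℂ) {c : ℝ} (hc : 0 ≤ c)
    (h : ∀ k l, ‖M k l‖ ≤ c) : ‖M‖ ≤ N * c := by
  lift c to NNReal using hc
  rw [Matrix.linfty_opNorm_def]
  have : (Finset.univ.sup fun i => ∑ j, ‖M i j‖₊) ≤ (N : NNReal) * c := by
    refine Finset.sup_le fun i _ => ?_
    refine (Finset.sum_le_card_nsmul _ _ c fun j _ => ?_).trans ?_
    · exact_mod_cast h i j
    · simp
  exact_mod_cast this

theorem hasDerivAt_iff_entry {Q : ℝ → Matrix (Fin N) (Fin N) ℂ}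
    {Q' : Matrix (Fin N) (Fin N) ℂ} {t : ℝ} :
    HasDerivAt Q Q' t ↔ ∀ k l, HasDerivAt (fun s => Q s k l) (Q' k l) t := by
  constructor
  · intro h k l
    exact ((Matrix.entryLinearMap ℝ ℂ k l).toContinuousLinearMap.hasFDerivAt
      (x := Q t)).comp_hasDerivAt t h
  · intro h
    have key : ∀ M : Matrix (Fin N) (Fin N) ℂ,
        M = ∑ k, ∑ l, M k l • Matrix.single k l (1 : ℂ) := fun M => by
      conv_lhs => rw [Matrix.matrix_eq_sum_single M]
      simp [Matrix.smul_single]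
    have h2 : HasDerivAt (fun s => ∑ k, ∑ l, Q s k l • Matrix.single k l (1 : ℂ))
        (∑ k, ∑ l, Q' k l • Matrix.single k l (1 : ℂ)) t :=
      HasDerivAt.fun_sum fun k _ => HasDerivAt.fun_sum fun l _ => (h k l).smul_const _
    rw [key Q']
    convert h2 using 1
    funext s
    exact key (Q s)

end MatrixNorm

/-! ### Power series in `ε`: identity theorem and Cauchy estimates -/

section PowerSeries

variable {E : Type*} [NormedAddCommGroup E] [NormedSpace ℂ E]

/-- Convergence at each real point `s < r` makes the terms tend to `0` there, so the radius of
convergence is at least `r`. -/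
theorem hasFPowerSeriesOnBall_of_hasSum {b : ℕ → E} {g : ℂ → E} {r : ℝ} (hr : 0 < r)
    (h : ∀ ε : ℂ, ‖ε‖ < r → HasSum (fun n : ℕ => ε ^ n • b n) (g ε)) :
    HasFPowerSeriesOnBall g (fun n => ContinuousMultilinearMap.mkPiRing ℂ (Fin n) (b n)) 0
      (ENNReal.ofReal r) where
  r_le := by
    refine ENNReal.le_of_forall_nnreal_lt fun s hs => ?_
    have hs' : (s : ℝ) < r := by
      rw [← ENNReal.ofReal_coe_nnreal] at hs
      exact (ENNReal.ofReal_lt_ofReal_iff hr).1 hs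
    refine FormalMultilinearSeries.le_radius_of_tendsto (l := 0) _ ?_
    have h1 := ((h (s : ℝ) (by simpa using hs')).summable.tendsto_atTop_zero).norm
    simpa [norm_smul, mul_comm] using h1
  r_pos := by simpa using hr
  hasSum := by
    intro y hy
    have : ‖y‖ < r := by
      simpa [Metric.mem_eball, edist_zero_right, ← ofReal_norm,
        ENNReal.ofReal_lt_ofReal_iff hr] using hy
    simpa using h y this

theorem coeff_eq_of_hasSum {b b' : ℕ → E} {g : ℂ → E} {r : ℝ} (hr : 0 < r)
    (h : ∀ ε : ℂ, ‖ε‖ < r → HasSum (fun n : ℕ => ε ^ n • b n) (g ε))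
    (h' : ∀ ε : ℂ, ‖ε‖ < r → HasSum (fun n : ℕ => ε ^ n • b' n) (g ε)) : b = b' := by
  have := (hasFPowerSeriesOnBall_of_hasSum hr h).hasFPowerSeriesAt.eq_formalMultilinearSeries
    (hasFPowerSeriesOnBall_of_hasSum hr h').hasFPowerSeriesAt
  funext n
  have h1 := congrFun this n
  simpa using congrArg (fun p => p fun _ => 1) h1

/-- Cauchy's estimate: by uniqueness of power series the `b n` are the Cauchy integrals over the
circle of radius `ρ`. -/
theorem norm_coeff_le_of_hasSum [CompleteSpace E] {b : ℕ → E} {g : ℂ → E} {r ρ M : ℝ}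
    (hρ : 0 < ρ) (hρr : ρ < r)
    (h : ∀ ε : ℂ, ‖ε‖ < r → HasSum (fun n : ℕ => ε ^ n • b n) (g ε))
    (hM : ∀ ε : ℂ, ‖ε‖ = ρ → ‖g ε‖ ≤ M) (n : ℕ) : ‖b n‖ ≤ M * ρ⁻¹ ^ n := by
  have hr := hρ.trans hρr
  have h1 := hasFPowerSeriesOnBall_of_hasSum hr h
  lift ρ to NNReal using hρ.le
  have hd : DifferentiableOn ℂ g (Metric.closedBall 0 ρ) := by
    refine h1.differentiableOn.mono fun y hy => ?_
    simp only [Metric.mem_closedBall, dist_zero_right] at hy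
    simp only [Metric.mem_eball, edist_zero_right, ← ofReal_norm]
    exact (ENNReal.ofReal_lt_ofReal_iff hr).2 (hy.trans_lt hρr)
  have h2 := hd.hasFPowerSeriesOnBall (by exact_mod_cast hρ)
  have h3 := congrFun (h1.hasFPowerSeriesAt.eq_formalMultilinearSeries h2.hasFPowerSeriesAt) n
  have h4 := norm_cauchyPowerSeries_le g 0 ρ n
  rw [← h3, ContinuousMultilinearMap.norm_mkPiRing, abs_of_pos hρ] at h4
  refine h4.trans (mul_le_mul_of_nonneg_right ?_ (by positivity))
  have h5 : ∫ θ in (0 : ℝ)..2 * Real.pi, ‖g (circleMap 0 ρ θ)‖ ≤ M * (2 * Real.pi) := by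
    have := intervalIntegral.norm_integral_le_of_norm_le_const (a := 0) (b := 2 * Real.pi)
      (f := fun θ => ‖g (circleMap 0 ρ θ)‖) (C := M) (fun θ _ => by
        rw [norm_norm]; exact hM _ (by simp))
    rw [sub_zero, abs_of_pos Real.two_pi_pos] at this
    exact (le_abs_self _).trans this
  have := Real.two_pi_pos
  rw [inv_mul_le_iff₀ this]
  linarith

end PowerSeries

/-! ### Majorants for quadratic recursions -/

section Majorant

/-- The map `(n, i) ↦ (i, n - i)` is injective into the square of indices in `[1, m)`, and all terms
are nonnegative. -/
theorem sum_Ico_convolution_le {y : ℕ → ℝ} (hy : ∀ n, 0 ≤ y n) (m : ℕ) :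
    ∑ n ∈ Finset.Ico 1 (m + 1), ∑ i ∈ Finset.Ico 1 n, y i * y (n - i) ≤
      (∑ n ∈ Finset.Ico 1 m, y n) ^ 2 := by
  rw [sq, Finset.sum_mul_sum, ← Finset.sum_product', Finset.sum_sigma']
  have hinj : Set.InjOn (fun p : (_ : ℕ) × ℕ => (p.2, p.1 - p.2))
      ((Finset.Ico 1 (m + 1)).sigma fun n => Finset.Ico 1 n) := by
    rintro ⟨n, i⟩ h ⟨n', i'⟩ h' he
    simp only [Finset.coe_sigma, Set.mem_sigma_iff, Finset.coe_Ico, Set.mem_Ico] at h h'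
    simp only [Prod.mk.injEq] at he
    obtain rfl : n = n' := by omega
    obtain rfl : i = i' := he.1
    rfl
  rw [← Finset.sum_image (f := fun p : ℕ × ℕ => y p.1 * y p.2) hinj]
  refine Finset.sum_le_sum_of_subset_of_nonneg ?_ fun p _ _ => mul_nonneg (hy _) (hy _)
  intro p hp
  simp only [Finset.mem_image, Finset.mem_sigma, Finset.mem_Ico] at hp
  obtain ⟨⟨n, i⟩, h, rfl⟩ := hp
  simp only [Finset.mem_product, Finset.mem_Ico]
  dsimp only at h
  omega

/-- A sequence satisfying a quadratic convolution inequality with geometric forcing grows at most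
geometrically. -/
theorem exists_geometric_bound_of_quadratic_recursion {w : ℕ → ℝ} {K L q : ℝ}
    (hw : ∀ n, 0 ≤ w n) (hK : 0 < K) (hL : 0 ≤ L) (hq : 0 < q)
    (h : ∀ n, 1 ≤ n → w n ≤ K * ∑ i ∈ Finset.Ico 1 n, w i * w (n - i) + L * q ^ n) :
    ∃ x : ℝ, 0 < x ∧ ∃ B : ℝ, ∀ n, w n * x ^ n ≤ B := by
  -- With `δ = L η / (1 - η)`, the total of the rescaled forcing, `4 K δ ≤ 1` is what lets the bound
  -- `2 δ` reproduce itself: `K (2 δ) ^ 2 + δ ≤ 2 δ`. The choice of `η` gives `η / (1 - η) = 1 / (1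
  -- + 4 K L)`.
  obtain ⟨η, hη, hη1, hη2⟩ : ∃ η : ℝ, 0 < η ∧ η < 1 ∧ 4 * K * (L * (η / (1 - η))) ≤ 1 := by
    refine ⟨1 / (2 + 4 * K * L), by positivity, ?_, ?_⟩
    · rw [div_lt_one (by positivity)]; nlinarith [mul_nonneg hK.le hL]
    · have h1 : 0 ≤ K * L := mul_nonneg hK.le hL
      have : 1 / (2 + 4 * K * L) / (1 - 1 / (2 + 4 * K * L)) = 1 / (1 + 4 * K * L) := by
        have h2 : (2 + 4 * K * L) ≠ 0 := by nlinarith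
        have h3 : (1 + 4 * K * L) ≠ 0 := by nlinarith
        rw [one_sub_div h2, div_div_div_cancel_right₀ h2]
        ring
      rw [this, mul_one_div, mul_div_assoc', div_le_one (by nlinarith)]
      nlinarith
  set δ := L * (η / (1 - η)) with hδ
  have hδ0 : 0 ≤ δ := mul_nonneg hL (div_nonneg hη.le (by linarith))
  -- Rescaling replaces the forcing ratio `q` by `η < 1` and respects convolution.
  set y : ℕ → ℝ := fun n => w n * (η / q) ^ n with hy
  have hy0 : ∀ n, 0 ≤ y n := fun n => mul_nonneg (hw n) (by positivity)
  have hrec : ∀ n, 1 ≤ n → y n ≤ K * ∑ i ∈ Finset.Ico 1 n, y i * y (n - i) + L * η ^ n := by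
    intro n hn
    have h1 := mul_le_mul_of_nonneg_right (h n hn) (by positivity : 0 ≤ (η / q) ^ n)
    refine h1.trans_eq ?_
    rw [add_mul, mul_assoc K, Finset.sum_mul, mul_assoc L, ← mul_pow, mul_div_cancel₀ _ hq.ne']
    congr 2
    refine Finset.sum_congr rfl fun i hi => ?_
    have : (η / q) ^ n = (η / q) ^ i * (η / q) ^ (n - i) := by
      rw [← pow_add, Nat.add_sub_cancel' (Finset.mem_Ico.1 hi).2.le]
    rw [this, hy]
    ring
  have hgeom : ∀ m, ∑ n ∈ Finset.Ico 1 m, L * η ^ n ≤ δ := by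
    intro m
    rw [← Finset.mul_sum]
    refine mul_le_mul_of_nonneg_left ?_ hL
    have := geom_sum_Ico_le_of_lt_one (m := 1) (n := m) hη.le hη1
    simpa using this
  have hS : ∀ m, ∑ n ∈ Finset.Ico 1 m, y n ≤ 2 * δ := by
    intro m
    induction m with
    | zero => simpa using hδ0
    | succ m ih =>
      have h1 : ∑ n ∈ Finset.Ico 1 (m + 1), y n ≤
          K * ∑ n ∈ Finset.Ico 1 (m + 1), ∑ i ∈ Finset.Ico 1 n, y i * y (n - i) +
            ∑ n ∈ Finset.Ico 1 (m + 1), L * η ^ n := by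
        rw [Finset.mul_sum, ← Finset.sum_add_distrib]
        exact Finset.sum_le_sum fun n hn => hrec n (Finset.mem_Ico.1 hn).1
      have h2 := sum_Ico_convolution_le hy0 m
      have h3 : (∑ n ∈ Finset.Ico 1 m, y n) ^ 2 ≤ (2 * δ) ^ 2 :=
        pow_le_pow_left₀ (Finset.sum_nonneg fun n _ => hy0 n) ih 2
      have h4 := mul_le_mul_of_nonneg_left (h2.trans h3) hK.le
      have h5 := mul_le_mul_of_nonneg_right hη2 hδ0
      have h6 := hgeom (m + 1)
      nlinarith
  refine ⟨η / q, by positivity, max (w 0) (2 * δ), fun n => ?_⟩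
  rcases Nat.eq_zero_or_pos n with rfl | hn
  · simp
  · refine le_max_of_le_right ?_
    have h1 : y n ≤ ∑ n ∈ Finset.Ico 1 (n + 1), y n :=
      Finset.single_le_sum (f := y) (fun i _ => hy0 i) (Finset.mem_Ico.2 ⟨hn, n.lt_succ_self⟩)
    exact h1.trans (hS _)

end Majorant

/-! ### Folding into the first Brillouin zone -/

section Brillouin

theorem freq_im (T : ℝ) (q : ℤ) : (freq T * (q : ℂ)).im = q * (2 * Real.pi / T) := by
  have : freq T * (q : ℂ) = ((q * (2 * Real.pi / T) : ℝ) : ℂ) * Complex.I := by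
    simp only [freq]; push_cast; ring
  rw [this]; simp

theorem freq_ne_zero {T : ℝ} (hT : 0 < T) : freq T ≠ 0 := by
  have := Real.pi_ne_zero
  simp [freq, hT.ne', this]

theorem exists_folding_inBrillouinZone {N : ℕ} {T : ℝ} (hT : 0 < T) (a : Fin N → ℂ) :
    ∃! f : Fin N → ℂ, (∃ ν, IsFolding T a f ν) ∧ InBrillouinZone T f := by
  have hp : 0 < 2 * Real.pi / T := by have := Real.pi_pos; positivity
  have hend : -(Real.pi / T) + 2 * Real.pi / T = Real.pi / T := by ring
  have key := fun k => existsUnique_sub_zsmul_mem_Ioc hp (a k).im (-(Real.pi / T))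
  simp only [hend, Set.mem_Ioc, zsmul_eq_mul] at key
  choose ν hν huniq using key
  refine ⟨fun k => a k - freq T * (ν k : ℂ), ⟨⟨ν, fun k => by ring⟩, fun k => ?_⟩, ?_⟩
  · rw [Complex.sub_im, freq_im]
    exact hν k
  · rintro g ⟨⟨μ, hμ⟩, hg⟩
    funext k
    have hgk : g k = a k - freq T * (μ k : ℂ) := by rw [← hμ k]; ring
    have h1 := hg k
    rw [hgk, Complex.sub_im, freq_im] at h1
    rw [hgk, huniq k _ h1]

/-- Two points of a half-open strip of height `2π/T` have imaginary parts differing by strictly less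
than `2π/T`, so only `q = 0` is possible. -/
theorem InBrillouinZone.isNonresonant {N : ℕ} {T : ℝ} (hT : 0 < T) {f : Fin N → ℂ}
    (h : InBrillouinZone T f) : IsNonresonant T f := by
  intro k l hne q hq
  have hp : 0 < 2 * Real.pi / T := by have := Real.pi_pos; positivity
  have him := congrArg Complex.im hq
  rw [freq_im, Complex.sub_im] at him
  have e : 2 * Real.pi / T = Real.pi / T + Real.pi / T := by ring
  have h1 := h k
  have h2 := h l
  have h3 : (q : ℝ) < 1 := by
    by_contra hc; push Not at hc; nlinarith
  have h4 : (-1 : ℝ) < q := by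
    by_contra hc; push Not at hc; nlinarith
  have h5 : q = 0 := by
    have h3' : q < 1 := by exact_mod_cast h3
    have h4' : -1 < q := by exact_mod_cast h4
    omega
  exact hne (sub_eq_zero.1 (by rw [hq, h5]; simp))

end Brillouin

/-! ### A priori estimate for the linearised boundary value problem -/

section LinearEstimate

theorem norm_le_of_norm_deriv_le {y y' : ℝ → ℂ} {T K : ℝ} (h0 : y 0 = 0)
    (hd : ∀ t ∈ Set.Icc 0 T, HasDerivAt y (y' t) t) (hb : ∀ t ∈ Set.Icc 0 T, ‖y' t‖ ≤ K)
    {t : ℝ} (ht : t ∈ Set.Icc 0 T) : ‖y t‖ ≤ K * T := by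
  have h := norm_image_sub_le_of_norm_deriv_le_segment' (fun x hx => (hd x hx).hasDerivWithinAt)
    (fun x hx => hb x ⟨hx.1, hx.2.le⟩) t ht
  rw [h0, sub_zero, sub_zero] at h
  have hK : 0 ≤ K := (norm_nonneg _).trans (hb t ht)
  exact h.trans (mul_le_mul_of_nonneg_left ht.2 hK)

theorem hasDerivAt_cexp_const_mul (c : ℂ) (t : ℝ) :
    HasDerivAt (fun s : ℝ => Complex.exp (c * s)) (c * Complex.exp (c * t)) t := by
  have h1 : HasDerivAt (fun z : ℂ => Complex.exp (c * z)) (Complex.exp (c * t) * (c * 1)) (t : ℂ) :=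
    ((hasDerivAt_id (t : ℂ)).const_mul c).cexp
  simpa [mul_comm] using h1.comp_ofReal

/-- `J T ≠ 0` is where nonresonance enters the estimate: for `c ≠ 0`, `exp (c T) = 1` would make `c`
an integer multiple of `freq T`. -/
theorem exists_primitive_cexp {T : ℝ} (hT : 0 < T) (c : ℂ) (hc : c ≠ 0 → ∀ q : ℤ, c ≠ freq T * q) :
    ∃ J : ℝ → ℂ, J 0 = 0 ∧ J T ≠ 0 ∧ (∀ t : ℝ, HasDerivAt J (Complex.exp (c * t)) t) := by
  by_cases h : c = 0
  · refine ⟨fun t => t, by simp, by simpa using hT.ne', fun t => ?_⟩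
    simpa [h] using (hasDerivAt_id (t : ℂ)).comp_ofReal
  · refine ⟨fun t => (Complex.exp (c * t) - 1) / c, by simp, ?_, fun t => ?_⟩
    · rw [div_ne_zero_iff]
      refine ⟨fun h0 => ?_, h⟩
      obtain ⟨q, hq⟩ := Complex.exp_eq_one_iff.1 (sub_eq_zero.1 h0)
      refine hc h q ?_
      have : (T : ℂ) ≠ 0 := by exact_mod_cast hT.ne'
      rw [freq]
      field_simp
      rw [hq]; ring
    · have := ((hasDerivAt_cexp_const_mul c t).sub_const 1).div_const c
      rwa [mul_div_cancel_left₀ _ h] at this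

/-- A priori estimate for a scalar linear equation with vanishing boundary values: the free
constant `d` and the solution `x` are controlled by the inhomogeneity `φ`. -/
theorem exists_scalar_bound {T : ℝ} (hT : 0 < T) (b c : ℂ)
    (hc : c ≠ 0 → ∀ q : ℤ, c ≠ freq T * q) :
    ∃ C : ℝ, 0 ≤ C ∧ ∀ (x φ : ℝ → ℂ) (d : ℂ) (s : ℝ), x 0 = 0 → x T = 0 →
      (∀ t ∈ Set.Icc 0 T,
        HasDerivAt x (b * x t + φ t - Complex.exp ((b + c) * t) * d) t) →
      (∀ t ∈ Set.Icc 0 T, ‖φ t‖ ≤ s) →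
      ‖d‖ ≤ C * s ∧ ∀ t ∈ Set.Icc 0 T, ‖x t‖ ≤ C * s := by
  obtain ⟨J, hJ0, hJT, hJ⟩ := exists_primitive_cexp hT c hc
  have hcont : ∀ z : ℂ, ∃ B : ℝ, 0 ≤ B ∧ ∀ t ∈ Set.Icc 0 T, ‖Complex.exp (z * (t : ℝ))‖ ≤ B := by
    intro z
    obtain ⟨B, hB⟩ := (isCompact_Icc (a := (0 : ℝ)) (b := T)).exists_bound_of_continuousOn
      (f := fun t : ℝ => Complex.exp (z * t)) (by fun_prop)
    exact ⟨B, (norm_nonneg _).trans (hB 0 ⟨le_rfl, hT.le⟩), hB⟩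
  obtain ⟨B₁, hB₁, hb₁⟩ := hcont (-b)
  obtain ⟨B₂, hB₂, hb₂⟩ := hcont b
  obtain ⟨B₃, hb₃⟩ := (isCompact_Icc (a := (0 : ℝ)) (b := T)).exists_bound_of_continuousOn
      (f := J) (fun t _ => (hJ t).continuousAt.continuousWithinAt)
  have hB₃ : 0 ≤ B₃ := (norm_nonneg _).trans (hb₃ 0 ⟨le_rfl, hT.le⟩)
  set C₁ := B₁ * T / ‖J T‖
  have hC₁ : 0 ≤ C₁ := by positivity
  have hC₂ : 0 ≤ B₂ * (B₁ * T + C₁ * B₃) := by positivity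
  refine ⟨C₁ + B₂ * (B₁ * T + C₁ * B₃), by positivity, fun x φ d s hx0 hxT hx hφ => ?_⟩
  have hs : 0 ≤ s := (norm_nonneg _).trans (hφ 0 ⟨le_rfl, hT.le⟩)
  -- Integrating factor plus `d J`: the unknown `d` drops out of `y'`, so `y` is bounded by `φ`
  -- alone. Since `x T = 0`, `y T = d * J T`, which then bounds `d`.
  set y : ℝ → ℂ := fun t => Complex.exp (-b * t) * x t + d * J t with hy
  have hy' : ∀ t ∈ Set.Icc 0 T, HasDerivAt y (Complex.exp (-b * t) * φ t) t := by
    intro t ht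
    have h1 := ((hasDerivAt_cexp_const_mul (-b) t).mul (hx t ht)).add ((hJ t).const_mul d)
    refine h1.congr_deriv ?_
    have : Complex.exp (c * t) = Complex.exp (-b * t) * Complex.exp ((b + c) * t) := by
      rw [← Complex.exp_add]; congr 1; ring
    rw [this]; ring
  have hyb : ∀ t ∈ Set.Icc 0 T, ‖y t‖ ≤ B₁ * s * T := fun t ht =>
    norm_le_of_norm_deriv_le (by simp [hy, hx0, hJ0]) hy' (fun t ht => by
      rw [norm_mul]
      exact mul_le_mul (hb₁ t ht) (hφ t ht) (norm_nonneg _) hB₁) ht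
  have hd : ‖d‖ ≤ C₁ * s := by
    have h1 := hyb T ⟨hT.le, le_rfl⟩
    simp only [hy, hxT, mul_zero, zero_add, norm_mul] at h1
    have h2 : 0 < ‖J T‖ := norm_pos_iff.2 hJT
    calc ‖d‖ ≤ B₁ * s * T / ‖J T‖ := (le_div_iff₀ h2).2 h1
      _ = C₁ * s := by simp only [C₁]; ring
  refine ⟨hd.trans (mul_le_mul_of_nonneg_right (by linarith) hs), fun t ht => ?_⟩
  have hxt : x t = Complex.exp (b * t) * (y t - d * J t) := by
    have : Complex.exp (b * t) * Complex.exp (-b * t) = 1 := by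
      rw [← Complex.exp_add]; simp
    simp only [hy, add_sub_cancel_right]
    rw [← mul_assoc, this, one_mul]
  have h3 : ‖x t‖ ≤ B₂ * (B₁ * s * T + C₁ * s * B₃) := by
    rw [hxt, norm_mul]
    refine mul_le_mul (hb₂ t ht) ((norm_sub_le _ _).trans (add_le_add (hyb t ht) ?_))
      (norm_nonneg _) hB₂
    rw [norm_mul]
    exact mul_le_mul hd (hb₃ t ht) (norm_nonneg _) (by positivity)
  refine h3.trans (le_of_sub_nonneg ?_)
  have : (C₁ + B₂ * (B₁ * T + C₁ * B₃)) * s - B₂ * (B₁ * s * T + C₁ * s * B₃) = C₁ * s := by ring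
  rw [this]; positivity

open scoped Matrix.Norms.Operator

variable {N : ℕ}

/-- The zeroth order periodic factor `diag (exp ((a k - f k) t))`. -/
def leadingP (a f : Fin N → ℂ) (t : ℝ) : Matrix (Fin N) (Fin N) ℂ :=
  Matrix.diagonal fun k => Complex.exp ((a k - f k) * t)

/-- The equation decouples into entries: entry `(k, l)` is the scalar problem with `b = a k - f l`
and `c = f l - f k`, so that `b + c = a k - f k` is the exponent of `leadingP`. -/
theorem exists_matrix_bound {T : ℝ} (hT : 0 < T) (a f : Fin N → ℂ) (hf : IsNonresonant T f) :
    ∃ C : ℝ, 0 ≤ C ∧ ∀ (Q S : ℝ → Matrix (Fin N) (Fin N) ℂ) (D : Matrix (Fin N) (Fin N) ℂ) (s : ℝ),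
      Q 0 = 0 → Q T = 0 →
      (∀ t ∈ Set.Icc 0 T, HasDerivAt Q
        (Matrix.diagonal a * Q t - Q t * Matrix.diagonal f + S t - leadingP a f t * D) t) →
      (∀ t ∈ Set.Icc 0 T, ‖S t‖ ≤ s) →
      ‖D‖ ≤ C * s ∧ ∀ t ∈ Set.Icc 0 T, ‖Q t‖ ≤ C * s := by
  have h := fun k l => exists_scalar_bound hT (a k - f l) (f l - f k)
    (fun hne => hf l k (sub_ne_zero.1 hne))
  choose c hc0 hc using h
  have hle : ∀ k l, c k l ≤ ∑ k, ∑ l, c k l := fun k l =>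
    (Finset.single_le_sum (f := fun l => c k l) (fun l _ => hc0 k l) (Finset.mem_univ l)).trans
      (Finset.single_le_sum (f := fun k => ∑ l, c k l)
        (fun k _ => Finset.sum_nonneg fun l _ => hc0 k l) (Finset.mem_univ k))
  have hnn : 0 ≤ ∑ k, ∑ l, c k l :=
    Finset.sum_nonneg fun k _ => Finset.sum_nonneg fun l _ => hc0 k l
  refine ⟨N * ∑ k, ∑ l, c k l, by positivity, fun Q S D s hQ0 hQT hQ hS => ?_⟩
  have hs : 0 ≤ s := (norm_nonneg _).trans (hS 0 ⟨le_rfl, hT.le⟩)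
  have hkl := fun k l => hc k l (fun t => Q t k l) (fun t => S t k l) (D k l) s
    (by simp [hQ0]) (by simp [hQT]) (fun t ht => by
      have h1 := hasDerivAt_iff_entry.1 (hQ t ht) k l
      convert h1 using 1
      simp only [leadingP, Matrix.sub_apply, Matrix.add_apply, Matrix.diagonal_mul,
        Matrix.mul_diagonal, sub_add_sub_cancel]
      ring) (fun t ht => (norm_entry_le _ k l).trans (hS t ht))
  constructor
  · rw [mul_assoc]
    exact norm_le_of_entry_le _ (by positivity) fun k l =>
      (hkl k l).1.trans (mul_le_mul_of_nonneg_right (hle k l) hs)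
  · intro t ht
    rw [mul_assoc]
    exact norm_le_of_entry_le _ (by positivity) fun k l =>
      ((hkl k l).2 t ht).trans (mul_le_mul_of_nonneg_right (hle k l) hs)

end LinearEstimate

/-! ### The algebra of finite Fourier series -/

section Fourier

open scoped Matrix.Norms.Operator

variable {N : ℕ} {T : ℝ}

theorem trigPoly_eq_sum (Φ : ℤ →₀ Matrix (Fin N) (Fin N) ℂ) (t : ℝ) :
    trigPoly T Φ t = Φ.sum fun m M => Complex.exp (freq T * (m : ℂ) * (t : ℂ)) • M := rfl

theorem hasFiniteFourierSeries_single (T : ℝ) (m : ℤ) (M : Matrix (Fin N) (Fin N) ℂ) :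
    HasFiniteFourierSeries T fun t => Complex.exp (freq T * (m : ℂ) * (t : ℂ)) • M :=
  ⟨Finsupp.single m M, fun t => by rw [trigPoly_eq_sum, Finsupp.sum_single_index (by simp)]⟩

theorem hasFiniteFourierSeries_const (T : ℝ) (M : Matrix (Fin N) (Fin N) ℂ) :
    HasFiniteFourierSeries T fun _ => M := by
  simpa using hasFiniteFourierSeries_single T 0 M

theorem HasFiniteFourierSeries.add {B B' : ℝ → Matrix (Fin N) (Fin N) ℂ}
    (h : HasFiniteFourierSeries T B) (h' : HasFiniteFourierSeries T B') :
    HasFiniteFourierSeries T fun t => B t + B' t := by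
  obtain ⟨Φ, hΦ⟩ := h
  obtain ⟨Ψ, hΨ⟩ := h'
  refine ⟨Φ + Ψ, fun t => ?_⟩
  simp only [hΦ, hΨ]
  rw [trigPoly_eq_sum, trigPoly_eq_sum, trigPoly_eq_sum,
    Finsupp.sum_add_index' (by simp) (by simp [smul_add])]

theorem hasFiniteFourierSeries_sum {ι : Type*} {s : Finset ι}
    {B : ι → ℝ → Matrix (Fin N) (Fin N) ℂ} (h : ∀ i ∈ s, HasFiniteFourierSeries T (B i)) :
    HasFiniteFourierSeries T fun t => ∑ i ∈ s, B i t := by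
  classical
  induction s using Finset.induction_on with
  | empty => simpa using hasFiniteFourierSeries_const T (0 : Matrix (Fin N) (Fin N) ℂ)
  | insert i s hi ih =>
    simp only [Finset.sum_insert hi]
    exact (h i (Finset.mem_insert_self i s)).add
      (ih fun j hj => h j (Finset.mem_insert_of_mem hj))

theorem HasFiniteFourierSeries.mul {B B' : ℝ → Matrix (Fin N) (Fin N) ℂ}
    (h : HasFiniteFourierSeries T B) (h' : HasFiniteFourierSeries T B') :
    HasFiniteFourierSeries T fun t => B t * B' t := by
  obtain ⟨Φ, hΦ⟩ := h
  obtain ⟨Ψ, hΨ⟩ := h'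
  simp only [hΦ, hΨ, trigPoly, Finset.sum_mul_sum]
  refine hasFiniteFourierSeries_sum fun m _ => hasFiniteFourierSeries_sum fun m' _ => ?_
  have := hasFiniteFourierSeries_single T (m + m') (Φ m * Ψ m')
  convert this using 2 with t
  rw [smul_mul_smul_comm, ← Complex.exp_add]
  push_cast
  ring_nf

theorem HasFiniteFourierSeries.sub {B B' : ℝ → Matrix (Fin N) (Fin N) ℂ}
    (h : HasFiniteFourierSeries T B) (h' : HasFiniteFourierSeries T B') :
    HasFiniteFourierSeries T fun t => B t - B' t := by
  simpa [sub_eq_add_neg] using h.add ((hasFiniteFourierSeries_const T (-1)).mul h')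

theorem hasFiniteFourierSeries_of_entry_eq_sum {B : ℝ → Matrix (Fin N) (Fin N) ℂ}
    {s : Fin N → Fin N → Finset ℤ} {c : Fin N → Fin N → ℤ → ℂ}
    (h : ∀ t k l, B t k l = ∑ m ∈ s k l, Complex.exp (freq T * (m : ℂ) * (t : ℂ)) * c k l m) :
    HasFiniteFourierSeries T B := by
  have hB : B = fun t : ℝ => ∑ k, ∑ l, ∑ m ∈ s k l,
      Complex.exp (freq T * (m : ℂ) * (t : ℂ)) • Matrix.single k l (c k l m) := by
    funext t
    conv_lhs => rw [Matrix.matrix_eq_sum_single (B t)]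
    refine Finset.sum_congr rfl fun k _ => Finset.sum_congr rfl fun l _ => ?_
    rw [h]
    simp only [Matrix.smul_single, smul_eq_mul]
    exact map_sum (Matrix.singleAddMonoidHom k l) _ _
  rw [hB]
  exact hasFiniteFourierSeries_sum fun k _ => hasFiniteFourierSeries_sum fun l _ =>
    hasFiniteFourierSeries_sum fun m _ => hasFiniteFourierSeries_single T m _

theorem periodic_exp_freq (hT : 0 < T) (m : ℤ) :
    Function.Periodic (fun t : ℝ => Complex.exp (freq T * (m : ℂ) * (t : ℂ))) T := by
  intro t
  have h : (T : ℂ) ≠ 0 := by exact_mod_cast hT.ne'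
  refine Complex.exp_eq_exp_iff_exists_int.2 ⟨m, ?_⟩
  rw [freq]
  push_cast
  field_simp

theorem HasFiniteFourierSeries.periodic (hT : 0 < T) {B : ℝ → Matrix (Fin N) (Fin N) ℂ}
    (h : HasFiniteFourierSeries T B) : Function.Periodic B T := by
  obtain ⟨Φ, hΦ⟩ := h
  intro t
  rw [hΦ, hΦ, trigPoly, trigPoly]
  exact Finset.sum_congr rfl fun m _ => congrArg (· • Φ m) (periodic_exp_freq hT m t)

theorem HasFiniteFourierSeries.continuous {B : ℝ → Matrix (Fin N) (Fin N) ℂ}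
    (h : HasFiniteFourierSeries T B) : Continuous B := by
  obtain ⟨Φ, hΦ⟩ := h
  rw [show B = trigPoly T Φ from funext hΦ]
  unfold trigPoly
  fun_prop

theorem trigPoly_apply (Φ : ℤ →₀ Matrix (Fin N) (Fin N) ℂ) (t : ℝ) (k l : Fin N) :
    trigPoly T Φ t k l = ∑ m ∈ Φ.support, Complex.exp (freq T * (m : ℂ) * (t : ℂ)) * Φ m k l := by
  simp [trigPoly, Matrix.sum_apply]

end Fourier

/-! ### The leading periodic factor -/

section Leading

open scoped Matrix.Norms.Operator

variable {N : ℕ} {T : ℝ} {a f : Fin N → ℂ} {ν : Fin N → ℤ}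

theorem leadingP_eq_exp (a f : Fin N → ℂ) (t : ℝ) :
    leadingP a f t = NormedSpace.exp (t • (Matrix.diagonal a - Matrix.diagonal f)) := by
  have : t • (Matrix.diagonal a - Matrix.diagonal f) =
      Matrix.diagonal fun k => (a k - f k) * (t : ℂ) := by
    rw [Matrix.diagonal_sub, ← Matrix.diagonal_smul]
    congr 1
    funext k
    simp [mul_comm]
  rw [this, Matrix.exp_diagonal, leadingP]
  congr 1
  funext k
  rw [Pi.coe_exp, Complex.exp_eq_exp_ℂ]

theorem IsFolding.hasFiniteFourierSeries_leadingP (h : IsFolding T a f ν) :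
    HasFiniteFourierSeries T (leadingP a f) := by
  refine hasFiniteFourierSeries_of_entry_eq_sum (s := fun k _ => {ν k})
    (c := fun k l _ => if k = l then 1 else 0) fun t k l => ?_
  simp [leadingP, Matrix.diagonal_apply, h k]

theorem leadingP_zero (a f : Fin N → ℂ) : leadingP a f 0 = 1 := by
  simp [leadingP]

theorem hasDerivAt_leadingP (a f : Fin N → ℂ) (t : ℝ) :
    HasDerivAt (leadingP a f)
      (Matrix.diagonal a * leadingP a f t - leadingP a f t * Matrix.diagonal f) t := by
  rw [hasDerivAt_iff_entry]
  intro k l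
  rcases eq_or_ne k l with rfl | hkl
  · have := hasDerivAt_cexp_const_mul (a k - f k) t
    simp only [leadingP, Matrix.diagonal_apply_eq, Matrix.sub_apply, Matrix.diagonal_mul_diagonal]
    exact this.congr_deriv (by ring)
  · simpa [leadingP, Matrix.diagonal_apply_ne _ hkl] using hasDerivAt_const t (0 : ℂ)

end Leading

/-! ### Solving order by order -/

section Recursion

open scoped Matrix.Norms.Operator

variable {N : ℕ} {T : ℝ} {a f : Fin N → ℂ} {ν : Fin N → ℤ}

/-- By folding, the denominator equals `freq T * (m - ν k) - (f k - f l)`; its vanishing would be a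
resonance, or `m = ν k` when `f k = f l`. -/
theorem denominator_ne_zero (hT : 0 < T) (h : IsFolding T a f ν) (hf : IsNonresonant T f)
    {k l : Fin N} {m : ℤ} (hm : f k = f l → m ≠ ν k) : freq T * (m : ℂ) - a k + f l ≠ 0 := by
  intro h0
  have h1 : f k - f l = freq T * ((m - ν k : ℤ) : ℂ) := by
    push_cast
    rw [mul_sub, ← h k]
    linear_combination -h0
  by_cases hkl : f k = f l
  · rw [hkl, sub_self, eq_comm, mul_eq_zero] at h1
    rcases h1 with h1 | h1
    · exact freq_ne_zero hT h1
    · exact hm hkl (sub_eq_zero.1 (by exact_mod_cast h1))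
  · exact hf k l hkl _ h1

/-- The functions given by the explicit formulas solve the order-`n` equation. -/
theorem hasDerivAt_of_formula (hT : 0 < T) (h : IsFolding T a f ν) (hf : IsNonresonant T f)
    {Φ : ℤ →₀ Matrix (Fin N) (Fin N) ℂ} {Fn : Matrix (Fin N) (Fin N) ℂ}
    {Pn : ℝ → Matrix (Fin N) (Fin N) ℂ} (hF : FormulaF T a f ν Φ Fn) (hP : FormulaP T a f ν Φ Pn)
    (t : ℝ) :
    HasDerivAt Pn (Matrix.diagonal a * Pn t - Pn t * Matrix.diagonal f + trigPoly T Φ t -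
      leadingP a f t * Fn) t := by
  classical
  rw [hasDerivAt_iff_entry]
  intro k l
  have hPkl : (fun s => Pn s k l) = fun s : ℝ => ∑ m ∈ insert (ν k) Φ.support,
      Complex.exp (freq T * (m : ℂ) * (s : ℂ)) * coeffP T a f ν Φ k l m := funext fun s => hP s k l
  rw [hPkl]
  have hd := HasDerivAt.fun_sum (u := insert (ν k) Φ.support) fun m _ =>
    (hasDerivAt_cexp_const_mul (freq T * (m : ℂ)) t).mul_const (coeffP T a f ν Φ k l m)
  refine hd.congr_deriv ?_
  simp only [leadingP, Matrix.sub_apply, Matrix.add_apply, Matrix.diagonal_mul, Matrix.mul_diagonal]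
  rw [trigPoly_apply, hP t k l, h k]
  -- The differential equation mode by mode. Row `k` of `leadingP` carries the single frequency `ν
  -- k`, so `Fn` enters only at `m = ν k`.
  have hcoef : ∀ m : ℤ, (freq T * (m : ℂ) - a k + f l) * coeffP T a f ν Φ k l m =
      Φ m k l - if m = ν k then Fn k l else 0 := by
    intro m
    by_cases hm : m = ν k
    · subst hm
      have e : freq T * (ν k : ℂ) - a k + f l = f l - f k := by rw [← h k]; ring
      simp only [coeffP, if_true, e]
      by_cases hkl : f k = f l
      · rw [(hF k l).1 hkl, hkl]; ring
      · rw [(hF k l).2 hkl]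
        have hs : ∑ m ∈ Φ.support, quot T a f Φ k l m =
            ∑ m ∈ Φ.support.erase (ν k), quot T a f Φ k l m + quot T a f Φ k l (ν k) := by
          by_cases hmem : ν k ∈ Φ.support
          · rw [Finset.sum_erase_add _ _ hmem]
          · rw [Finset.erase_eq_of_notMem hmem]
            simp [quot, Finsupp.notMem_support_iff.1 hmem]
        have hne : f l - f k ≠ 0 := sub_ne_zero.2 (Ne.symm hkl)
        rw [hs, mul_add, quot, e, mul_div_cancel₀ _ hne]
        ring
    · simp only [coeffP, if_neg hm, quot, sub_zero]
      exact mul_div_cancel₀ _ (denominator_ne_zero hT h hf fun _ => hm)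
  have hΦ : ∑ m ∈ Φ.support, Complex.exp (freq T * (m : ℂ) * (t : ℂ)) * Φ m k l =
      ∑ m ∈ insert (ν k) Φ.support, Complex.exp (freq T * (m : ℂ) * (t : ℂ)) * Φ m k l := by
    refine Finset.sum_subset (Finset.subset_insert _ _) fun m _ hm => ?_
    simp [Finsupp.notMem_support_iff.1 hm]
  have hFn : Complex.exp (freq T * (ν k : ℂ) * (t : ℂ)) * Fn k l =
      ∑ m ∈ insert (ν k) Φ.support, Complex.exp (freq T * (m : ℂ) * (t : ℂ)) *
        (if m = ν k then Fn k l else 0) := by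
    rw [Finset.sum_eq_single_of_mem (ν k) (Finset.mem_insert_self _ _)
      (fun m _ hm => by rw [if_neg hm, mul_zero]), if_pos rfl]
  rw [hΦ, hFn, Finset.mul_sum, Finset.sum_mul, ← Finset.sum_sub_distrib, ← Finset.sum_add_distrib,
    ← Finset.sum_sub_distrib]
  refine Finset.sum_congr rfl fun m _ => ?_
  linear_combination Complex.exp (freq T * (m : ℂ) * (t : ℂ)) * hcoef m

/-- The coefficient at `ν k` was chosen as minus the sum of all others. -/
theorem FormulaP.apply_zero {Φ : ℤ →₀ Matrix (Fin N) (Fin N) ℂ}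
    {Pn : ℝ → Matrix (Fin N) (Fin N) ℂ} (hP : FormulaP T a f ν Φ Pn) : Pn 0 = 0 := by
  ext k l
  rw [hP 0 k l]
  simp only [Complex.ofReal_zero, mul_zero, Complex.exp_zero, one_mul, Matrix.zero_apply]
  rw [← Finset.add_sum_erase _ _ (Finset.mem_insert_self (ν k) _), Finset.erase_insert_eq_erase,
    coeffP, if_pos rfl, neg_add_eq_zero]
  exact Finset.sum_congr rfl fun m hm => (if_neg (Finset.ne_of_mem_erase hm)).symm

theorem FormulaP.hasFiniteFourierSeries {Φ : ℤ →₀ Matrix (Fin N) (Fin N) ℂ}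
    {Pn : ℝ → Matrix (Fin N) (Fin N) ℂ} (hP : FormulaP T a f ν Φ Pn) :
    HasFiniteFourierSeries T Pn :=
  hasFiniteFourierSeries_of_entry_eq_sum hP

theorem exists_formula (T : ℝ) (a f : Fin N → ℂ) (ν : Fin N → ℤ)
    (Φ : ℤ →₀ Matrix (Fin N) (Fin N) ℂ) :
    ∃ X : Matrix (Fin N) (Fin N) ℂ × (ℝ → Matrix (Fin N) (Fin N) ℂ),
      FormulaF T a f ν Φ X.1 ∧ FormulaP T a f ν Φ X.2 := by
  classical
  refine ⟨(Matrix.of fun k l => if f k = f l then Φ (ν k) k l else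
    (f l - f k) * ∑ m ∈ Φ.support, quot T a f Φ k l m, fun t => Matrix.of fun k l =>
      ∑ m ∈ insert (ν k) Φ.support,
        Complex.exp (freq T * (m : ℂ) * (t : ℂ)) * coeffP T a f ν Φ k l m),
    fun k l => ⟨fun hkl => ?_, fun hkl => ?_⟩, fun t k l => rfl⟩
  all_goals simp [hkl]

/-- Course-of-values recursion by choice. By `hcongr` only values below `n` matter to `R n`, so the
tail may be filled with `default`. -/
theorem exists_sequence_of_step {X : Type*} [Inhabited X] (R : ℕ → (ℕ → X) → X → Prop)
    (hex : ∀ n s, (∀ m < n, R m s (s m)) → ∃ x, R n s x)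
    (hcongr : ∀ n s s' x, (∀ m < n, s m = s' m) → R n s x → R n s' x) :
    ∃ s : ℕ → X, ∀ n, R n s (s n) := by
  classical
  let s : ℕ → X := fun n => Nat.strongRec (motive := fun _ => X) (fun n ih =>
    Classical.epsilon (R n fun m => if h : m < n then ih m h else default)) n
  have hs : ∀ n, s n = Classical.epsilon (R n fun m => if m < n then s m else default) := by
    intro n
    simp only [s]
    rw [Nat.strongRec_eq]
    rfl
  refine ⟨s, fun n => ?_⟩
  induction n using Nat.strong_induction_on with
  | _ n ih =>
    have h1 : ∀ m < n, (fun m => if m < n then s m else default) m = s m := fun m hm => if_pos hm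
    obtain ⟨x, hx⟩ := hex n s ih
    have h2 := Classical.epsilon_spec (⟨x, hcongr n _ _ x (fun m hm => (h1 m hm).symm) hx⟩ :
      ∃ x, R n (fun m => if m < n then s m else default) x)
    rw [← hs] at h2
    exact hcongr n _ _ _ h1 h2

theorem source_congr {A : ℕ → ℝ → Matrix (Fin N) (Fin N) ℂ}
    {F F' : ℕ → Matrix (Fin N) (Fin N) ℂ} {P P' : ℕ → ℝ → Matrix (Fin N) (Fin N) ℂ} {n : ℕ}
    (hn : 1 ≤ n) (hF : ∀ m < n, F m = F' m) (hP : ∀ m < n, P m = P' m) (t : ℝ) :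
    source A F P n t = source A F' P' n t := by
  unfold source
  rw [hP 0 hn]
  congr 1
  refine Finset.sum_congr rfl fun i hi => ?_
  rw [Finset.mem_Ico] at hi
  rw [hP (n - i) (by omega), hF i hi.2]

theorem hasFiniteFourierSeries_source {A : ℕ → ℝ → Matrix (Fin N) (Fin N) ℂ}
    {F : ℕ → Matrix (Fin N) (Fin N) ℂ} {P : ℕ → ℝ → Matrix (Fin N) (Fin N) ℂ} {n : ℕ}
    (hn : 1 ≤ n) (hA : ∀ n, 1 ≤ n → HasFiniteFourierSeries T (A n))
    (hP : ∀ m < n, HasFiniteFourierSeries T (P m)) :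
    HasFiniteFourierSeries T (source A F P n) := by
  refine HasFiniteFourierSeries.add (hasFiniteFourierSeries_sum fun i hi => ?_)
    ((hA n hn).mul (hP 0 hn))
  rw [Finset.mem_Ico] at hi
  have h1 := hP (n - i) (by omega)
  exact ((hA i hi.1).mul h1).sub (h1.mul (hasFiniteFourierSeries_const T _))

/-- The formal solution: coefficients defined recursively by the explicit formulas. -/
theorem exists_formal_solution {A : ℕ → ℝ → Matrix (Fin N) (Fin N) ℂ}
    (hA : ∀ n, 1 ≤ n → HasFiniteFourierSeries T (A n)) (h : IsFolding T a f ν) :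
    ∃ (F : ℕ → Matrix (Fin N) (Fin N) ℂ) (P : ℕ → ℝ → Matrix (Fin N) (Fin N) ℂ),
      F 0 = Matrix.diagonal f ∧ P 0 = leadingP a f ∧ (∀ n, HasFiniteFourierSeries T (P n)) ∧
      ∀ n, 1 ≤ n → ∃ Φ : ℤ →₀ Matrix (Fin N) (Fin N) ℂ,
        (∀ t : ℝ, source A F P n t = trigPoly T Φ t) ∧
        FormulaF T a f ν Φ (F n) ∧ FormulaP T a f ν Φ (P n) := by
  -- Finiteness of the Fourier series is part of the relation, so that the next source is again a
  -- trigonometric polynomial.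
  let R : ℕ → (ℕ → Matrix (Fin N) (Fin N) ℂ × (ℝ → Matrix (Fin N) (Fin N) ℂ)) →
      Matrix (Fin N) (Fin N) ℂ × (ℝ → Matrix (Fin N) (Fin N) ℂ) → Prop := fun n s x =>
    HasFiniteFourierSeries T x.2 ∧
      (n = 0 → x = (Matrix.diagonal f, leadingP a f)) ∧
      (1 ≤ n → ∃ Φ : ℤ →₀ Matrix (Fin N) (Fin N) ℂ,
        (∀ t : ℝ, source A (fun m => (s m).1) (fun m => (s m).2) n t = trigPoly T Φ t) ∧
        FormulaF T a f ν Φ x.1 ∧ FormulaP T a f ν Φ x.2)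
  suffices hR : ∃ s, ∀ n, R n s (s n) by
    obtain ⟨s, hs⟩ := hR
    exact ⟨fun n => (s n).1, fun n => (s n).2, by simp [(hs 0).2.1 rfl],
      by simp [(hs 0).2.1 rfl], fun n => (hs n).1, fun n => (hs n).2.2⟩
  refine exists_sequence_of_step R ?_ ?_
  · intro n s ih
    rcases Nat.eq_zero_or_pos n with rfl | hn
    · exact ⟨(Matrix.diagonal f, leadingP a f), h.hasFiniteFourierSeries_leadingP, fun _ => rfl,
        fun h => absurd h (by norm_num)⟩
    · obtain ⟨Φ, hΦ⟩ := hasFiniteFourierSeries_source (F := fun m => (s m).1)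
        (P := fun m => (s m).2) hn hA fun m hm => (ih m hm).1
      obtain ⟨x, hx1, hx2⟩ := exists_formula T a f ν Φ
      exact ⟨x, hx2.hasFiniteFourierSeries, fun h0 => absurd h0 hn.ne',
        fun _ => ⟨Φ, hΦ, hx1, hx2⟩⟩
  · rintro n s s' x hss ⟨h1, h2, h3⟩
    refine ⟨h1, h2, fun hn => ?_⟩
    obtain ⟨Φ, hΦ, hx⟩ := h3 hn
    refine ⟨Φ, fun t => ?_, hx⟩
    rw [← hΦ t]
    exact source_congr hn (fun m hm => by rw [hss m hm]) (fun m hm => by rw [hss m hm]) t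

end Recursion

/-! ### Convergence of the formal solution -/

section Convergence

open scoped Matrix.Norms.Operator

variable {N : ℕ} {T : ℝ} {a f : Fin N → ℂ} {ν : Fin N → ℤ}

/-- Joint continuity bounds the family on a compact cylinder of radius `r / 2`, so Cauchy's estimate
is uniform in `t`. -/
theorem IsAnalyticFamily.exists_coeff_bound {r : ℝ} (hr : 0 < r)
    {B : ℂ → ℝ → Matrix (Fin N) (Fin N) ℂ} {b : ℕ → ℝ → Matrix (Fin N) (Fin N) ℂ}
    (h : IsAnalyticFamily r B b) (T : ℝ) :
    ∃ M q : ℝ, 0 ≤ M ∧ 0 < q ∧ ∀ n, ∀ t ∈ Set.Icc 0 T, ‖b n t‖ ≤ M * q ^ n := by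
  have hρ : 0 < r / 2 := by positivity
  have hK : IsCompact (Metric.closedBall (0 : ℂ) (r / 2) ×ˢ Set.Icc 0 T) :=
    (isCompact_closedBall _ _).prod isCompact_Icc
  obtain ⟨M, hM⟩ := hK.exists_bound_of_continuousOn (h.continuousOn.mono (Set.prod_mono
    (Metric.closedBall_subset_ball (by linarith)) (Set.subset_univ _)))
  refine ⟨max M 0, (r / 2)⁻¹, le_max_right _ _, by positivity, fun n t ht => ?_⟩
  exact norm_coeff_le_of_hasSum hρ (by linarith) (fun ε hε => h.hasSum ε hε t)
    (fun ε hε => (hM (ε, t) ⟨by simp [hε], ht⟩).trans (le_max_left _ _)) n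

/-- The end terms of the two Cauchy products supply `A_0 P_n`, `P_n F_0`, `A_n P_0` and `P_0 F_n`;
all but `A_n P_0` lie outside `source`. -/
theorem hasDerivAt_coeff {A : ℕ → ℝ → Matrix (Fin N) (Fin N) ℂ}
    {F : ℕ → Matrix (Fin N) (Fin N) ℂ} {P : ℕ → ℝ → Matrix (Fin N) (Fin N) ℂ}
    (hA₀ : ∀ t, A 0 t = Matrix.diagonal a) (hF₀ : F 0 = Matrix.diagonal f) (hP₀ : P 0 = leadingP a f)
    (hP : ∀ n, 1 ≤ n → ∀ t, HasDerivAt (P n) (Matrix.diagonal a * P n t -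
      P n t * Matrix.diagonal f + source A F P n t - leadingP a f t * F n) t) (n : ℕ) (t : ℝ) :
    HasDerivAt (P n) (∑ p ∈ Finset.HasAntidiagonal.antidiagonal n, A p.1 t * P p.2 t -
      ∑ p ∈ Finset.HasAntidiagonal.antidiagonal n, P p.1 t * F p.2) t := by
  rcases Nat.eq_zero_or_pos n with rfl | hn
  · simpa [hA₀, hF₀, hP₀] using hasDerivAt_leadingP a f t
  · refine (hP n hn t).congr_deriv ?_
    rw [← Finset.Nat.sum_antidiagonal_swap (f := fun p : ℕ × ℕ => P p.1 t * F p.2),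
      ← Finset.sum_sub_distrib]
    rw [Finset.Nat.sum_antidiagonal_eq_sum_range_succ_mk, Finset.sum_range_succ,
      Finset.range_eq_Ico, Finset.sum_eq_sum_Ico_succ_bot hn]
    simp only [source, Prod.fst_swap, Prod.snd_swap, Nat.sub_zero, Nat.sub_self, hA₀, hF₀, hP₀]
    abel

theorem source_norm_le {A : ℕ → ℝ → Matrix (Fin N) (Fin N) ℂ}
    {F : ℕ → Matrix (Fin N) (Fin N) ℂ} {P : ℕ → ℝ → Matrix (Fin N) (Fin N) ℂ} {n : ℕ} {t : ℝ}
    {α v : ℕ → ℝ} (hA : ∀ i, ‖A i t‖ ≤ α i) (hF : ∀ i, ‖F i‖ ≤ v i) (hP : ∀ i, ‖P i t‖ ≤ v i) :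
    ‖source A F P n t‖ ≤
      ∑ i ∈ Finset.Ico 1 n, (v i + α i) * (v (n - i) + α (n - i)) + α n * v 0 := by
  have hα : ∀ i, 0 ≤ α i := fun i => (norm_nonneg _).trans (hA i)
  have hv : ∀ i, 0 ≤ v i := fun i => (norm_nonneg _).trans (hP i)
  refine (norm_add_le _ _).trans (add_le_add (norm_sum_le_of_le _ fun i _ => ?_) ?_)
  · have h1 : ‖A i t * P (n - i) t‖ ≤ α i * v (n - i) :=
      (norm_mul_le _ _).trans (mul_le_mul (hA i) (hP _) (norm_nonneg _) (hα i))
    have h2 : ‖P (n - i) t * F i‖ ≤ v (n - i) * v i :=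
      (norm_mul_le _ _).trans (mul_le_mul (hP _) (hF i) (norm_nonneg _) (hv _))
    have h3 := mul_nonneg (hv i) (hα (n - i))
    have h4 := mul_nonneg (hα i) (hα (n - i))
    refine (norm_sub_le _ _).trans ?_
    nlinarith
  · exact (norm_mul_le _ _).trans (mul_le_mul (hA n) (hP 0) (norm_nonneg _) (hα n))

theorem exists_formal_solution_bound (hT : 0 < T) (hf : IsNonresonant T f)
    {A : ℕ → ℝ → Matrix (Fin N) (Fin N) ℂ} {F : ℕ → Matrix (Fin N) (Fin N) ℂ}
    {P : ℕ → ℝ → Matrix (Fin N) (Fin N) ℂ} {M q : ℝ} (hM : 0 ≤ M) (hq : 0 < q)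
    (hA : ∀ n, ∀ t ∈ Set.Icc 0 T, ‖A n t‖ ≤ M * q ^ n)
    (hPcont : ∀ n, Continuous (P n)) (hPper : ∀ n, Function.Periodic (P n) T)
    (hPzero : ∀ n, 1 ≤ n → P n 0 = 0)
    (hP : ∀ n, 1 ≤ n → ∀ t, HasDerivAt (P n) (Matrix.diagonal a * P n t -
      P n t * Matrix.diagonal f + source A F P n t - leadingP a f t * F n) t) :
    ∃ x B : ℝ, 0 < x ∧ ∀ n, ‖F n‖ * x ^ n ≤ B ∧ ∀ t, ‖P n t‖ * x ^ n ≤ B := by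
  obtain ⟨C, hC0, hC⟩ := exists_matrix_bound hT a f hf
  have hmax : ∀ n, ∃ s ∈ Set.Icc 0 T, ∀ t ∈ Set.Icc 0 T, ‖P n t‖ ≤ ‖P n s‖ := fun n =>
    (isCompact_Icc (a := (0 : ℝ)) (b := T)).exists_isMaxOn ⟨0, le_rfl, hT.le⟩
      (hPcont n).norm.continuousOn
  choose s hs hsmax using hmax
  set v : ℕ → ℝ := fun n => ‖F n‖ + ‖P n (s n)‖ with hv
  have hv0 : ∀ n, 0 ≤ v n := fun n => by positivity
  have hFv : ∀ n, ‖F n‖ ≤ v n := fun n => le_add_of_nonneg_right (norm_nonneg _)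
  have hPv : ∀ n, ∀ t ∈ Set.Icc 0 T, ‖P n t‖ ≤ v n := fun n t ht =>
    (hsmax n t ht).trans (le_add_of_nonneg_left (norm_nonneg _))
  -- Adding the bound for `A n` to `v` turns the source estimate into a pure self-convolution of
  -- `w`. Below, `2 * C` comes from bounding `F n` and `P n` separately, and `+ 1` keeps the
  -- constant positive.
  set w : ℕ → ℝ := fun n => v n + M * q ^ n with hw
  have hα0 : ∀ n, 0 ≤ M * q ^ n := fun n => by positivity
  have hrec : ∀ n, 1 ≤ n → w n ≤ (2 * C + 1) * ∑ i ∈ Finset.Ico 1 n, w i * w (n - i) +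
      (2 * C * M * v 0 + M) * q ^ n := by
    intro n hn
    have hPT : P n T = 0 := by
      have := hPper n 0
      rwa [zero_add, hPzero n hn] at this
    obtain ⟨h1, h2⟩ := hC (P n) (source A F P n) (F n) _ (hPzero n hn) hPT
      (fun t _ => hP n hn t) (fun t ht => source_norm_le (fun i => hA i t ht) hFv
        (fun i => hPv i t ht))
    have h3 := h2 (s n) (hs n)
    have h4 : 0 ≤ ∑ i ∈ Finset.Ico 1 n, w i * w (n - i) := Finset.sum_nonneg fun i _ =>
      mul_nonneg (add_nonneg (hv0 _) (hα0 _)) (add_nonneg (hv0 _) (hα0 _))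
    change v n + M * q ^ n ≤ _
    change ‖F n‖ ≤ C * (∑ i ∈ Finset.Ico 1 n, w i * w (n - i) + M * q ^ n * v 0) at h1
    change ‖P n (s n)‖ ≤ C * (∑ i ∈ Finset.Ico 1 n, w i * w (n - i) + M * q ^ n * v 0) at h3
    simp only [hv] at h1 h3 ⊢
    linarith
  obtain ⟨x, hx, B, hB⟩ := exists_geometric_bound_of_quadratic_recursion
    (fun n => add_nonneg (hv0 n) (hα0 n)) (by positivity)
    (add_nonneg (mul_nonneg (by positivity) (hv0 0)) hM) hq hrec
  have hvB : ∀ n, v n * x ^ n ≤ B := fun n =>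
    (mul_le_mul_of_nonneg_right (le_add_of_nonneg_right (hα0 n)) (by positivity)).trans (hB n)
  refine ⟨x, B, hx, fun n => ⟨?_, fun t => ?_⟩⟩
  · exact (mul_le_mul_of_nonneg_right (hFv n) (by positivity)).trans (hvB n)
  · obtain ⟨t', ht', he⟩ := (hPper n).exists_mem_Ico₀ hT t
    rw [he]
    exact (mul_le_mul_of_nonneg_right (hPv n t' ⟨ht'.1, ht'.2.le⟩) (by positivity)).trans (hvB n)

theorem norm_pow_smul_le {E : Type*} [NormedAddCommGroup E] [NormedSpace ℂ E] {ε : ℂ} {x B : ℝ}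
    (hε : ‖ε‖ ≤ x / 2) {n : ℕ} {b : E} (hb : ‖b‖ * x ^ n ≤ B) : ‖ε ^ n • b‖ ≤ B * (1 / 2) ^ n := by
  rw [norm_smul, norm_pow]
  calc ‖ε‖ ^ n * ‖b‖ ≤ (x / 2) ^ n * ‖b‖ :=
        mul_le_mul_of_nonneg_right (pow_le_pow_left₀ (norm_nonneg _) hε n) (norm_nonneg _)
    _ = ‖b‖ * x ^ n * (1 / 2) ^ n := by rw [div_pow, div_pow, one_pow]; ring
    _ ≤ B * (1 / 2) ^ n := mul_le_mul_of_nonneg_right hb (by positivity)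

theorem norm_sum_antidiagonal_le {R : Type*} [NormedRing R] {u v : ℕ → R} {U V : ℝ}
    (hu : ∀ n, ‖u n‖ ≤ U * (1 / 2) ^ n) (hv : ∀ n, ‖v n‖ ≤ V * (1 / 2) ^ n) (n : ℕ) :
    ‖∑ p ∈ Finset.HasAntidiagonal.antidiagonal n, u p.1 * v p.2‖ ≤ U * V * ((n + 1) * (1 / 2) ^ n) := by
  have h : ∀ p ∈ Finset.HasAntidiagonal.antidiagonal n, ‖u p.1 * v p.2‖ ≤ U * V * (1 / 2) ^ n := by
    intro p hp
    rw [← Finset.HasAntidiagonal.mem_antidiagonal.1 hp, pow_add]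
    have := mul_le_mul (hu p.1) (hv p.2) (norm_nonneg _) ((norm_nonneg _).trans (hu p.1))
    exact ((norm_mul_le _ _).trans this).trans_eq (by ring)
  refine (norm_sum_le_of_le _ h).trans_eq ?_
  rw [Finset.sum_const, Finset.Nat.card_antidiagonal, nsmul_eq_mul]
  push_cast
  ring

theorem summable_succ_mul_half_pow : Summable fun n : ℕ => ((n : ℝ) + 1) * (1 / 2) ^ n := by
  have h1 := summable_pow_mul_geometric_of_norm_lt_one (R := ℝ) 1 (r := 1 / 2) (by norm_num)
  have h2 := summable_geometric_of_lt_one (r := (1 / 2 : ℝ)) (by norm_num) (by norm_num)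
  refine (h1.add h2).congr fun n => ?_
  rw [pow_one]; ring

/-- Termwise differentiation of a product-type power series. -/
theorem hasDerivAt_tsum_of_coeff {A : ℕ → ℝ → Matrix (Fin N) (Fin N) ℂ}
    {F : ℕ → Matrix (Fin N) (Fin N) ℂ} {P : ℕ → ℝ → Matrix (Fin N) (Fin N) ℂ}
    (hP : ∀ n t, HasDerivAt (P n) (∑ p ∈ Finset.HasAntidiagonal.antidiagonal n, A p.1 t * P p.2 t -
      ∑ p ∈ Finset.HasAntidiagonal.antidiagonal n, P p.1 t * F p.2) t) {ε : ℂ} {M B : ℝ}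
    (hA : ∀ n t, ‖ε ^ n • A n t‖ ≤ M * (1 / 2) ^ n) (hF : ∀ n, ‖ε ^ n • F n‖ ≤ B * (1 / 2) ^ n)
    (hPb : ∀ n t, ‖ε ^ n • P n t‖ ≤ B * (1 / 2) ^ n) (t : ℝ) :
    HasDerivAt (fun s => ∑' n, ε ^ n • P n s)
      ((∑' n, ε ^ n • A n t) * (∑' n, ε ^ n • P n t) -
        (∑' n, ε ^ n • P n t) * (∑' n, ε ^ n • F n)) t := by
  have hgeo : ∀ K : ℝ, Summable fun n : ℕ => K * (1 / 2) ^ n := fun K =>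
    (summable_geometric_of_lt_one (by norm_num) (by norm_num)).mul_left K
  have hsA := fun t => Summable.of_norm_bounded (hgeo M)
    (f := fun n => ‖ε ^ n • A n t‖) fun n => by rw [norm_norm]; exact hA n t
  have hsP := fun t => Summable.of_norm_bounded (hgeo B)
    (f := fun n => ‖ε ^ n • P n t‖) fun n => by rw [norm_norm]; exact hPb n t
  have hsF := Summable.of_norm_bounded (hgeo B)
    (f := fun n => ‖ε ^ n • F n‖) fun n => by rw [norm_norm]; exact hF n
  have hsmul : ∀ (u v : ℕ → Matrix (Fin N) (Fin N) ℂ) (n : ℕ),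
      ε ^ n • ∑ p ∈ Finset.HasAntidiagonal.antidiagonal n, u p.1 * v p.2 =
        ∑ p ∈ Finset.HasAntidiagonal.antidiagonal n, (ε ^ p.1 • u p.1) * (ε ^ p.2 • v p.2) := by
    intro u v n
    rw [Finset.smul_sum]
    refine Finset.sum_congr rfl fun p hp => ?_
    rw [smul_mul_smul_comm, ← pow_add, Finset.HasAntidiagonal.mem_antidiagonal.1 hp]
  -- The differentiated terms are Cauchy products with `n + 1` summands each, dominated uniformly in
  -- `s` by multiples of `(n + 1) / 2 ^ n`.
  have hder := hasDerivAt_tsum (g := fun (n : ℕ) (s : ℝ) => ε ^ n • P n s)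
    (g' := fun (n : ℕ) (s : ℝ) => ∑ p ∈ Finset.HasAntidiagonal.antidiagonal n, (ε ^ p.1 • A p.1 s) * (ε ^ p.2 • P p.2 s) -
      ∑ p ∈ Finset.HasAntidiagonal.antidiagonal n, (ε ^ p.1 • P p.1 s) * (ε ^ p.2 • F p.2))
    (u := fun n : ℕ => (M * B + B * B) * ((n + 1) * (1 / 2) ^ n)) (y₀ := 0)
    (summable_succ_mul_half_pow.mul_left _)
    (fun n s => by
      have := (hP n s).const_smul (ε ^ n)
      rw [smul_sub, hsmul (fun i => A i s) (fun i => P i s), hsmul (fun i => P i s) F] at this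
      exact this)
    (fun n s => by
      refine (norm_sub_le _ _).trans ?_
      rw [add_mul]
      exact add_le_add
        (norm_sum_antidiagonal_le (fun n => hA n s) (fun n => hPb n s) n)
        (norm_sum_antidiagonal_le (fun n => hPb n s) hF n))
    (hsP 0).of_norm t
  refine hder.congr_deriv ?_
  exact (((summable_norm_sum_mul_antidiagonal_of_summable_norm (hsA t)
    (hsP t)).of_norm).tsum_sub
      (summable_norm_sum_mul_antidiagonal_of_summable_norm (hsP t) hsF).of_norm).trans
    (congrArg₂ (· - ·)
      (tsum_mul_tsum_eq_tsum_sum_antidiagonal_of_summable_norm (hsA t) (hsP t)).symm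
      (tsum_mul_tsum_eq_tsum_sum_antidiagonal_of_summable_norm (hsP t) hsF).symm)

theorem isFloquetDecomposition_of_hasDerivAt {A P : ℝ → Matrix (Fin N) (Fin N) ℂ}
    {F : Matrix (Fin N) (Fin N) ℂ} (hper : Function.Periodic P T) (h0 : P 0 = 1)
    (h : ∀ t, HasDerivAt P (A t * P t - P t * F) t) : IsFloquetDecomposition T A P F where
  periodic := hper
  fundamental :=
    { initial := by simp [h0]
      deriv := by
        intro t
        rw [← hasDerivAt_iff_entry (Q := fun t => P t * NormedSpace.exp (t • F))]
        refine ((h t).mul (hasDerivAt_exp_smul_const' F t)).congr_deriv ?_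
        noncomm_ring }

theorem isAnalyticFloquetExpansion_of_formal {r₀ : ℝ} (hT : 0 < T) (hr₀ : 0 < r₀)
    {Aε : ℂ → ℝ → Matrix (Fin N) (Fin N) ℂ} {A : ℕ → ℝ → Matrix (Fin N) (Fin N) ℂ}
    (hA : IsAnalyticFamily r₀ Aε A) (hA₀ : ∀ t, A 0 t = Matrix.diagonal a)
    (hfin : ∀ n, 1 ≤ n → HasFiniteFourierSeries T (A n)) (hν : IsFolding T a f ν)
    (hf : IsNonresonant T f) {F : ℕ → Matrix (Fin N) (Fin N) ℂ}
    {P : ℕ → ℝ → Matrix (Fin N) (Fin N) ℂ} (hF₀ : F 0 = Matrix.diagonal f)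
    (hP₀ : P 0 = leadingP a f) (hPfin : ∀ n, HasFiniteFourierSeries T (P n))
    (hformula : ∀ n, 1 ≤ n → ∃ Φ : ℤ →₀ Matrix (Fin N) (Fin N) ℂ,
      (∀ t : ℝ, source A F P n t = trigPoly T Φ t) ∧
      FormulaF T a f ν Φ (F n) ∧ FormulaP T a f ν Φ (P n)) :
    IsAnalyticFloquetExpansion T r₀ Aε F P := by
  obtain ⟨M, q, hM, hq, hMq⟩ := hA.exists_coeff_bound hr₀ T
  have hAper : ∀ n, Function.Periodic (A n) T := by
    intro n
    rcases Nat.eq_zero_or_pos n with rfl | hn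
    · intro t; rw [hA₀, hA₀]
    · exact (hfin n hn).periodic hT
  have hPper : ∀ n, Function.Periodic (P n) T := fun n => (hPfin n).periodic hT
  have hPzero : ∀ n, 1 ≤ n → P n 0 = 0 := fun n hn => by
    obtain ⟨Φ, -, -, h⟩ := hformula n hn
    exact h.apply_zero
  have hPder : ∀ n, 1 ≤ n → ∀ t, HasDerivAt (P n) (Matrix.diagonal a * P n t -
      P n t * Matrix.diagonal f + source A F P n t - leadingP a f t * F n) t := fun n hn t => by
    obtain ⟨Φ, h1, h2, h3⟩ := hformula n hn
    rw [h1]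
    exact hasDerivAt_of_formula hT hν hf h2 h3 t
  obtain ⟨x, B, hx, hB⟩ := exists_formal_solution_bound hT hf hM hq hMq
    (fun n => (hPfin n).continuous) hPper hPzero hPder
  have hAB : ∀ n t, ‖A n t‖ * q⁻¹ ^ n ≤ M := by
    intro n t
    obtain ⟨t', ht', he⟩ := (hAper n).exists_mem_Ico₀ hT t
    rw [he, inv_pow, mul_inv_le_iff₀ (by positivity)]
    exact hMq n t' ⟨ht'.1, ht'.2.le⟩
  have hgeo : Summable fun n : ℕ => B * (1 / 2 : ℝ) ^ n :=
    (summable_geometric_of_lt_one (by norm_num) (by norm_num)).mul_left B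
  -- Half of each growth radius makes the series for `F`, `P` and `A` geometric with ratio `1 / 2`.
  set r := min r₀ (min (x / 2) (q⁻¹ / 2)) with hr
  have hrx : ∀ {ε : ℂ}, ‖ε‖ < r → ‖ε‖ ≤ x / 2 := fun h =>
    h.le.trans ((min_le_right _ _).trans (min_le_left _ _))
  have hrq : ∀ {ε : ℂ}, ‖ε‖ < r → ‖ε‖ ≤ q⁻¹ / 2 := fun h =>
    h.le.trans ((min_le_right _ _).trans (min_le_right _ _))
  have hsF : ∀ ε : ℂ, ‖ε‖ < r → Summable fun n => ε ^ n • F n := fun ε hε =>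
    Summable.of_norm_bounded hgeo fun n => norm_pow_smul_le (hrx hε) (hB n).1
  have hsP : ∀ ε : ℂ, ‖ε‖ < r → ∀ t, Summable fun n => ε ^ n • P n t := fun ε hε t =>
    Summable.of_norm_bounded hgeo fun n => norm_pow_smul_le (hrx hε) ((hB n).2 t)
  refine ⟨r, by positivity, min_le_left _ _, fun ε => ∑' n, ε ^ n • F n,
    fun ε t => ∑' n, ε ^ n • P n t, fun ε hε => (hsF ε hε).hasSum,
    ⟨?_, fun ε hε t => (hsP ε hε t).hasSum⟩, fun ε hε => ?_⟩
  · refine continuousOn_tsum (f := fun n (p : ℂ × ℝ) => p.1 ^ n • P n p.2) (fun n => ?_) hgeo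
      fun n p hp => norm_pow_smul_le (hrx (by simpa using hp.1)) ((hB n).2 _)
    have := (hPfin n).continuous
    fun_prop
  · refine isFloquetDecomposition_of_hasDerivAt (fun t => ?_) ?_ fun t => ?_
    · exact tsum_congr fun n => by rw [hPper n t]
    · beta_reduce
      rw [tsum_eq_single 0 fun n hn => by rw [hPzero n (Nat.pos_of_ne_zero hn), smul_zero]]
      rw [hP₀, leadingP_zero, pow_zero, one_smul]
    · have h1 := hasDerivAt_tsum_of_coeff (hasDerivAt_coeff hA₀ hF₀ hP₀ hPder)
        (fun n t => norm_pow_smul_le (hrq hε) (hAB n t))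
        (fun n => norm_pow_smul_le (hrx hε) (hB n).1)
        (fun n t => norm_pow_smul_le (hrx hε) ((hB n).2 t)) t
      rwa [(hA.hasSum ε (hε.trans_le (min_le_left _ _)) t).tsum_eq] at h1

end Convergence

/-! ### Uniqueness of the expansion -/

section Uniqueness

open scoped Matrix.Norms.Operator

variable {N : ℕ} {T : ℝ} {a f : Fin N → ℂ} {ν : Fin N → ℤ}

theorem IsFloquetDecomposition.apply_zero {A P : ℝ → Matrix (Fin N) (Fin N) ℂ}
    {F : Matrix (Fin N) (Fin N) ℂ} (h : IsFloquetDecomposition T A P F) : P 0 = 1 := by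
  simpa using h.fundamental.initial

theorem mul_exp_product_rule {R : Type*} [Ring R] (e e' x p y : R) :
    x * (p * e) * e' + p * e * (e' * -y) = x * (p * e * e') - p * e * e' * y := by
  simp only [mul_assoc, mul_neg, sub_eq_add_neg]

/-- Differentiability of `P` is not part of the definition; it follows from `P t = X t * exp (-t
F)`. -/
theorem IsFloquetDecomposition.hasDerivAt {A P : ℝ → Matrix (Fin N) (Fin N) ℂ}
    {F : Matrix (Fin N) (Fin N) ℂ} (h : IsFloquetDecomposition T A P F) (t : ℝ) :
    HasDerivAt P (A t * P t - P t * F) t := by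
  have hX := hasDerivAt_iff_entry.2 (h.fundamental.deriv t)
  have hinv : ∀ s : ℝ, NormedSpace.exp (s • F) * NormedSpace.exp (s • -F) = 1 := fun s => by
    rw [smul_neg, Matrix.exp_neg]
    exact Matrix.mul_nonsing_inv _ ((Matrix.isUnit_iff_isUnit_det _).1 (Matrix.isUnit_exp _))
  have hP : P = fun s => P s * NormedSpace.exp (s • F) * NormedSpace.exp (s • -F) := by
    funext s
    rw [mul_assoc, hinv, mul_one]
  rw [hP]
  refine (hX.mul (hasDerivAt_exp_smul_const (-F) t)).congr_deriv ?_
  exact mul_exp_product_rule _ _ _ _ _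

/-- Joint continuity together with compactness of `[0, T]` gives one neighbourhood of `0` serving
all `t`. -/
theorem eventually_norm_sub_le {r : ℝ} (hr : 0 < r) {G : ℂ → ℝ → Matrix (Fin N) (Fin N) ℂ}
    (hG : ContinuousOn (fun p : ℂ × ℝ => G p.1 p.2) (Metric.ball (0 : ℂ) r ×ˢ Set.univ)) (T : ℝ)
    {η : ℝ} (hη : 0 < η) : ∀ᶠ ε in 𝓝 (0 : ℂ), ∀ t ∈ Set.Icc 0 T, ‖G ε t - G 0 t‖ ≤ η := by
  refine isCompact_Icc.eventually_forall_of_forall_eventually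
    (P := fun ε t => ‖G ε t - G 0 t‖ ≤ η) fun t _ => ?_
  have hopen : IsOpen (Metric.ball (0 : ℂ) r ×ˢ (Set.univ : Set ℝ)) :=
    Metric.isOpen_ball.prod isOpen_univ
  have hmem : ∀ t : ℝ, ((0 : ℂ), t) ∈ Metric.ball (0 : ℂ) r ×ˢ (Set.univ : Set ℝ) := fun t =>
    ⟨Metric.mem_ball_self hr, Set.mem_univ _⟩
  have hc1 : ContinuousAt (fun p : ℂ × ℝ => G p.1 p.2) (0, t) :=
    hG.continuousAt (hopen.mem_nhds (hmem t))
  have hc2 : ContinuousAt (fun p : ℂ × ℝ => G 0 p.2) (0, t) := by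
    have h1 : ContinuousAt (fun p : ℂ × ℝ => ((0 : ℂ), p.2)) (0, t) := by fun_prop
    exact ContinuousAt.comp (g := fun p : ℂ × ℝ => G p.1 p.2) (f := fun p : ℂ × ℝ => ((0 : ℂ), p.2))
      hc1 h1
  have h := (hc1.sub hc2).norm
  have hlt := h.eventually_lt (continuousAt_const (y := η)) (by simpa using hη)
  exact hlt.mono fun p hp => le_of_lt hp

theorem eventually_norm_sub_le_of_hasSum {r : ℝ} (hr : 0 < r)
    {G : ℂ → Matrix (Fin N) (Fin N) ℂ} {g : ℕ → Matrix (Fin N) (Fin N) ℂ}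
    (hG : ∀ ε : ℂ, ‖ε‖ < r → HasSum (fun n : ℕ => ε ^ n • g n) (G ε)) {η : ℝ} (hη : 0 < η) :
    ∀ᶠ ε in 𝓝 (0 : ℂ), ‖G ε - g 0‖ ≤ η := by
  have hp := hasFPowerSeriesOnBall_of_hasSum hr hG
  have h0 : g 0 = G 0 := by simpa using hp.coeff_zero fun _ => 1
  have h := (hp.hasFPowerSeriesAt.continuousAt.sub (continuousAt_const (y := g 0))).norm
  exact (h.eventually_lt (continuousAt_const (y := η)) (by simpa [h0] using hη)).mono
    fun p hp => le_of_lt hp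

/-- Two Floquet decompositions of the same equation which are close to the leading order
decomposition coincide on a period. -/
theorem floquet_eq_of_close {C η : ℝ} (hT : 0 < T) (hC0 : 0 ≤ C) (hCη : 3 * (C * η) < 1 / 2)
    (hC : ∀ (Q S : ℝ → Matrix (Fin N) (Fin N) ℂ) (D : Matrix (Fin N) (Fin N) ℂ) (s : ℝ),
      Q 0 = 0 → Q T = 0 →
      (∀ t ∈ Set.Icc 0 T, HasDerivAt Q
        (Matrix.diagonal a * Q t - Q t * Matrix.diagonal f + S t - leadingP a f t * D) t) →
      (∀ t ∈ Set.Icc 0 T, ‖S t‖ ≤ s) →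
      ‖D‖ ≤ C * s ∧ ∀ t ∈ Set.Icc 0 T, ‖Q t‖ ≤ C * s)
    {A P P' : ℝ → Matrix (Fin N) (Fin N) ℂ} {F F' : Matrix (Fin N) (Fin N) ℂ}
    (h : IsFloquetDecomposition T A P F) (h' : IsFloquetDecomposition T A P' F')
    (hA : ∀ t ∈ Set.Icc 0 T, ‖A t - Matrix.diagonal a‖ ≤ η)
    (hP : ∀ t ∈ Set.Icc 0 T, ‖P t - leadingP a f t‖ ≤ η)
    (hF' : ‖F' - Matrix.diagonal f‖ ≤ η) : F' = F ∧ P' = P := by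
  set Q : ℝ → Matrix (Fin N) (Fin N) ℂ := fun t => P' t - P t with hQ
  have hη : 0 ≤ η := (norm_nonneg _).trans hF'
  have hQ0 : Q 0 = 0 := by simp [hQ, h.apply_zero, h'.apply_zero]
  have hQper : Function.Periodic Q T := fun t => by simp only [hQ, h.periodic t, h'.periodic t]
  have hQT : Q T = 0 := by rw [← hQ0, ← hQper 0, zero_add]
  -- The exact identity is `Q' = A Q - Q F' - P (F' - F)`. Freezing `A`, `F'`, `P` at leading order
  -- leaves products of an `η`-small factor with `Q` or `F' - F`; hence closeness is needed only for
  -- `P` of one decomposition and `F'` of the other.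
  have hQd : ∀ t, HasDerivAt Q (Matrix.diagonal a * Q t - Q t * Matrix.diagonal f +
      ((A t - Matrix.diagonal a) * Q t - Q t * (F' - Matrix.diagonal f) -
        (P t - leadingP a f t) * (F' - F)) - leadingP a f t * (F' - F)) t := fun t => by
    refine ((h'.hasDerivAt t).sub (h.hasDerivAt t)).congr_deriv ?_
    simp only [hQ]
    noncomm_ring
  have hQc : Continuous Q := continuous_iff_continuousAt.2 fun t => (hQd t).continuousAt
  obtain ⟨s, hs, hsmax⟩ := (isCompact_Icc (a := (0 : ℝ)) (b := T)).exists_isMaxOn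
    ⟨0, le_rfl, hT.le⟩ hQc.norm.continuousOn
  obtain ⟨h1, h2⟩ := hC Q _ (F' - F) (η * ‖Q s‖ + ‖Q s‖ * η + η * ‖F' - F‖) hQ0 hQT
    (fun t _ => hQd t) (fun t ht => by
      have hm : ‖Q t‖ ≤ ‖Q s‖ := hsmax ht
      refine (norm_sub_le _ _).trans (add_le_add ((norm_sub_le _ _).trans (add_le_add ?_ ?_)) ?_)
      · exact (norm_mul_le _ _).trans (mul_le_mul (hA t ht) hm (norm_nonneg _) hη)
      · exact (norm_mul_le _ _).trans (mul_le_mul hm hF' (norm_nonneg _) (norm_nonneg _))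
      · exact (norm_mul_le _ _).trans (mul_le_mul_of_nonneg_right (hP t ht) (norm_nonneg _)))
  have h3 := h2 s hs
  have hCη0 : 0 ≤ C * η := mul_nonneg hC0 hη
  -- The two estimates add up to at most `4 C η < 2 / 3` times the left side.
  have hz : ‖F' - F‖ + ‖Q s‖ ≤ 0 := by
    nlinarith [norm_nonneg (F' - F), norm_nonneg (Q s)]
  have hF0 : ‖F' - F‖ = 0 := by linarith [norm_nonneg (F' - F), norm_nonneg (Q s)]
  have hQs : ‖Q s‖ = 0 := by linarith [norm_nonneg (F' - F), norm_nonneg (Q s)]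
  refine ⟨sub_eq_zero.1 (norm_eq_zero.1 hF0), funext fun t => ?_⟩
  obtain ⟨t', ht', he⟩ := hQper.exists_mem_Ico₀ hT t
  have hm : ‖Q t'‖ ≤ ‖Q s‖ := hsmax ⟨ht'.1, ht'.2.le⟩
  rw [hQs] at hm
  have : Q t = 0 := by rw [he]; exact norm_le_zero_iff.1 hm
  exact sub_eq_zero.1 this

theorem IsAnalyticFamily.apply_zero {r : ℝ} (hr : 0 < r) {B : ℂ → ℝ → Matrix (Fin N) (Fin N) ℂ}
    {b : ℕ → ℝ → Matrix (Fin N) (Fin N) ℂ} (h : IsAnalyticFamily r B b) (t : ℝ) :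
    B 0 t = b 0 t := by
  rw [← (h.hasSum 0 (by simpa using hr) t).tsum_eq, tsum_eq_single 0]
  · simp
  · intro n hn
    simp [hn]

theorem IsAnalyticFloquetExpansion.unique {r₀ : ℝ} (hT : 0 < T) (hr₀ : 0 < r₀)
    {Aε : ℂ → ℝ → Matrix (Fin N) (Fin N) ℂ} {A : ℕ → ℝ → Matrix (Fin N) (Fin N) ℂ}
    (hA : IsAnalyticFamily r₀ Aε A) (hA₀ : ∀ t, A 0 t = Matrix.diagonal a)
    (hf : IsNonresonant T f) {F F' : ℕ → Matrix (Fin N) (Fin N) ℂ}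
    {P P' : ℕ → ℝ → Matrix (Fin N) (Fin N) ℂ}
    (hP₀ : P 0 = leadingP a f) (h : IsAnalyticFloquetExpansion T r₀ Aε F P)
    (h' : IsAnalyticFloquetExpansion T r₀ Aε F' P') (hF₀' : F' 0 = Matrix.diagonal f) :
    F' = F ∧ P' = P := by
  obtain ⟨r, hr, -, G, R, hG, hR, hdec⟩ := h
  obtain ⟨r', hr', -, G', R', hG', hR', hdec'⟩ := h'
  obtain ⟨C, hC0, hC⟩ := exists_matrix_bound hT a f hf
  obtain ⟨η, hη, hCη⟩ : ∃ η : ℝ, 0 < η ∧ 3 * (C * η) < 1 / 2 := by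
    refine ⟨1 / (6 * C + 6), by positivity, ?_⟩
    rw [← mul_assoc, mul_one_div, div_lt_div_iff₀ (by positivity) (by norm_num)]
    linarith
  have e1 := eventually_norm_sub_le hr₀ hA.continuousOn T hη
  have e2 := eventually_norm_sub_le hr hR.continuousOn T hη
  have e3 := eventually_norm_sub_le_of_hasSum hr' hG' hη
  obtain ⟨ρ, hρ, hball⟩ := Metric.eventually_nhds_iff.1 (e1.and (e2.and e3))
  simp only [dist_zero_right] at hball
  set d := min ρ (min r r') with hd
  have hdpos : 0 < d := by positivity
  have hdr : ∀ {ε : ℂ}, ‖ε‖ < d → ‖ε‖ < r := fun h =>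
    h.trans_le ((min_le_right _ _).trans (min_le_left _ _))
  have hdr' : ∀ {ε : ℂ}, ‖ε‖ < d → ‖ε‖ < r' := fun h =>
    h.trans_le ((min_le_right _ _).trans (min_le_right _ _))
  have heq : ∀ ε : ℂ, ‖ε‖ < d → G' ε = G ε ∧ R' ε = R ε := by
    intro ε hε
    obtain ⟨b1, b2, b3⟩ := hball (hε.trans_le (min_le_left _ _))
    refine floquet_eq_of_close hT hC0 hCη hC (hdec ε (hdr hε)) (hdec' ε (hdr' hε))
      (fun t ht => ?_) (fun t ht => ?_) ?_
    · have := b1 t ht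
      rwa [hA.apply_zero hr₀, hA₀] at this
    · have := b2 t ht
      rwa [hR.apply_zero hr, hP₀] at this
    · rwa [hF₀'] at b3
  constructor
  · refine coeff_eq_of_hasSum hdpos (fun ε hε => hG' ε (hdr' hε)) fun ε hε => ?_
    rw [(heq ε hε).1]
    exact hG ε (hdr hε)
  · have key : ∀ t, (fun n => P' n t) = fun n => P n t := fun t => by
      refine coeff_eq_of_hasSum hdpos (fun ε hε => hR'.hasSum ε (hdr' hε) t) fun ε hε => ?_
      rw [(heq ε hε).2]
      exact hR.hasSum ε (hdr hε) t
    funext n t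
    exact congrFun (key t) n

end Uniqueness

end FloquetLyapunov

end

/-! ### The main theorem -/

theorem theorem3p1 (N : ℕ) (T : ℝ) (hT : 0 < T) (r₀ : ℝ) (hr₀ : 0 < r₀)
    (Aε : ℂ → ℝ → Matrix (Fin N) (Fin N) ℂ) (A : ℕ → ℝ → Matrix (Fin N) (Fin N) ℂ)
    (hper : ∀ ε : ℂ, ‖ε‖ < r₀ → Function.Periodic (Aε ε) T)
    (hA : FloquetLyapunov.IsAnalyticFamily r₀ Aε A)
    (a : Fin N → ℂ) (hA₀ : ∀ t, A 0 t = Matrix.diagonal a)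
    (hfin : ∀ n, 1 ≤ n → FloquetLyapunov.HasFiniteFourierSeries T (A n)) :
    -- the reduction of `A₀` to the first Brillouin zone exists and is unique
    (∃! f : Fin N → ℂ, (∃ ν, FloquetLyapunov.IsFolding T a f ν) ∧
      FloquetLyapunov.InBrillouinZone T f) ∧
    -- and it is a feasible choice of `F₀`
    (∀ f : Fin N → ℂ, FloquetLyapunov.InBrillouinZone T f → FloquetLyapunov.IsNonresonant T f) ∧
    -- for every feasible choice of `F₀ = diag f`, and in particular for the above one:
    (∀ (f : Fin N → ℂ) (ν : Fin N → ℤ), FloquetLyapunov.IsFolding T a f ν →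
      FloquetLyapunov.IsNonresonant T f →
      ∃ (F : ℕ → Matrix (Fin N) (Fin N) ℂ) (P : ℕ → ℝ → Matrix (Fin N) (Fin N) ℂ),
        FloquetLyapunov.IsAnalyticFloquetExpansion T r₀ Aε F P ∧
        F 0 = Matrix.diagonal f ∧
        (∀ t : ℝ, P 0 t = NormedSpace.exp (t • (Matrix.diagonal a - Matrix.diagonal f))) ∧
        (∀ n, 1 ≤ n → ∃ Φ : ℤ →₀ Matrix (Fin N) (Fin N) ℂ,
          (∀ t : ℝ, FloquetLyapunov.source A F P n t = FloquetLyapunov.trigPoly T Φ t) ∧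
          FloquetLyapunov.FormulaF T a f ν Φ (F n) ∧
          FloquetLyapunov.FormulaP T a f ν Φ (P n)) ∧
        (∀ (F' : ℕ → Matrix (Fin N) (Fin N) ℂ) (P' : ℕ → ℝ → Matrix (Fin N) (Fin N) ℂ),
          FloquetLyapunov.IsAnalyticFloquetExpansion T r₀ Aε F' P' →
          F' 0 = Matrix.diagonal f → F' = F ∧ P' = P)) := by
  exact ⟨FloquetLyapunov.exists_folding_inBrillouinZone hT a, fun f hf => hf.isNonresonant hT,
    fun f ν hν hf => by
      obtain ⟨F, P, hF₀, hP₀, hPfin, hformula⟩ :=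
        FloquetLyapunov.exists_formal_solution hfin hν
      have hexp := FloquetLyapunov.isAnalyticFloquetExpansion_of_formal hT hr₀ hA hA₀ hfin hν hf
        hF₀ hP₀ hPfin hformula
      exact ⟨F, P, hexp, hF₀, fun t => by rw [hP₀, FloquetLyapunov.leadingP_eq_exp], hformula,
        fun F' P' h' hF₀' => hexp.unique hT hr₀ hA hA₀ hf hP₀ h' hF₀'⟩⟩
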